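/- **Logics.** Strictly positive formulas over a set of diamond modalities are built from propositional variables and $\top$ by $\land$ and the modalities. A normal strictly positive logic is a set of sequents $A\vdash B$ that contains $A\vdash A$, $A\vdash\top$, $A\land B\vdash A$, $A\land B\vdash B$ and is closed under substitution and the rules: from $A\vdash B$, $B\vdash C$ infer $A\vdash C$; from $A\vdash B$, $A\vdash C$ infer $A\vdash B\land C$; from $A\vdash B$ infer $aA\vdash aB$ for each modality $a$. $\mathrm{RC}$ is the least such logic in the modalities $\Diamond_n$ $(n\in\omega)$ containing $$\Diamond_n\Diamond_nA\vdash\Diamond_nA;\qquad \Diamond_nA\vdash\Diamond_mA,\quad \Diamond_nA\land\Diamond_mB\vdash\Diamond_n(A\land\Diamond_mB)\quad\text{for } n>m.$$ $\mathrm{RC}^\nabla$ is the least such logic in the modalities $\Diamond_n,\nabla_n$ $(n\in\omega)$ containing these axioms for the $\Diamond_n$, the same axioms for the $\nabla_n$, and $A\vdash\nabla_nA$; $\Diamond_nA\vdash\nabla_nA$; $\Diamond_m\nabla_nA\vdash\Diamond_mA$ and $\nabla_n\Diamond_mA\vdash\Diamond_mA$ for $m\le n$. **(i)** The Lindenbaum–Tarski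 algebra of the variable-free fragment of $\mathrm{RC}^\nabla$ is the set of variable-free formulas of $\mathrm{RC}^\nabla$ modulo provable equivalence in $\mathrm{RC}^\nabla$, with the induced operations $\land,\Diamond_n,\nabla_n$. **(ii)** Let $\ell(0)=0$ and $\ell(\delta+\omega^\gamma)=\gamma$. Let $I$ be the set of sequences $\vec\alpha=(\alpha_0,\alpha_1,\dots)$ of ordinals $<\varepsilon_0$ such that $\alpha_{i+1}\le\ell(\alpha_i)$ for all $i$, ordered by $\vec\alpha\le\vec\beta$ iff $\alpha_i\ge\beta_i$ for all $i$; this is a meet-semilattice. The Ignatiev $\mathrm{RC}^\nabla$-algebra $\mathfrak I$ is $I$ with its meet $\land$ and the operations $$\nabla_n(\vec\alpha)=(\alpha_0,\dots,\alpha_n,0,0,\dots),\qquad \Diamond_n(\vec\alpha)=(\beta_0,\dots,\beta_n,0,0,\dots),$$ where $\beta_{n+1}=0$ and $\beta_i=\alpha_i+\omega^{\beta_{i+1}}$ for $i\le n$. **(iii)** In this item all formulas are variable-free formulas of $\mathrm{RC}$. An $\mathrm{RC}$-theory is a set $T$ of formulas such that $B\in T$ whenever $A_1\land\dots\land A_k\vdash_{\mathrm{RC}}B$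 with $A_1,\dots,A_k\in T$, $k\ge0$ (the empty conjunction is $\top$); it is bounded if $T\subseteq\{B:A\vdash_{\mathrm{RC}}B\}$ for some formula $A$. Let $\mathfrak T$ be the set of bounded $\mathrm{RC}$-theories, $T\land S$ the theory generated by $T\cup S$, and $\nabla_nT$ the theory generated by $\{\Diamond_mA: \Diamond_mA\in T,\ m\le n\}$. We identify a formula with the theory it generates. Let $W_n$ be the set of formulas built from $\top$ by the modalities $\Diamond_i$, $i\ge n$, only. If $T\in\mathfrak T$ is generated by a subset of $W_n$, let $D_nT$ be the theory generated by $\Diamond_nA$, where $A\in W_n$ is such that $\nabla_nA=\nabla_nT$. For any $T\in\mathfrak T$ let $\Diamond_nT=D_0T_0\land D_1T_1\land\dots\land D_nT_n$, where $T_i$ is the theory generated by $T\cap W_i$. **(iv)** For $\vec\alpha,\vec\beta\in I$ let $\vec\alpha R_n\vec\beta$ iff $\alpha_i=\beta_i$ for all $i<n$ and $\alpha_n>\beta_n$; the Ignatiev frame is $I$ with the relations $R_n$. A cone is a nonempty set of the form $\{\vec\beta\in I:\beta_i\ge\alpha_i\text{ for all }i\}$, where $\vec\alpha$ is a sequence of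 ordinals $\le\varepsilon_0$. Let $\mathfrak C$ be the set of all cones with the operations $\cap$, $$\Diamond_n(C)=\bigcap_{i\le n}R_i^{-1}(C),\qquad \nabla_n(C)=\bigcap\{R_i^{-1}(D): D\in\mathfrak C,\ i\le n,\ R_i^{-1}(D)\supseteq C\},$$ where $R_i^{-1}(C)=\{\vec\alpha\in I:\exists\vec\beta\in C\ \vec\alpha R_i\vec\beta\}$ and the intersection of the empty family is $I$. **Theorem.** The operations $D_n$ in (iii) are well defined: for each $T\in\mathfrak T$ generated by a subset of $W_n$, a formula $A$ as required exists, and the theory generated by $\Diamond_nA$ does not depend on its choice. The following four structures are isomorphic (by bijections preserving $\land$, all $\Diamond_n$ and all $\nabla_n$): 1. the Lindenbaum–Tarski algebra of the variable-free fragment of $\mathrm{RC}^\nabla$; 2. the Ignatiev $\mathrm{RC}^\nabla$-algebra $\mathfrak I=(I,\land,\{\Diamond_n,\nabla_n:n\in\omega\})$; 3. the semilattice of bounded variable-free $\mathrm{RC}$-theories $(\mathfrak T,\land,\{\Diamond_n,\nabla_n:n\in\omega\})$; 4. the algebra of cones of the Ignatiev frame $(\mathfrak C,\cap,\{\Diamond_n,\nabla_n:n\in\omega\})$.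 -/

import Mathlib

noncomputable section

namespace RCNabla

open Ordinal
open scoped Ordinal

/-! ## Strictly positive formulas and logics -/

/-- Strictly positive formulas over a signature `S` of diamond modalities, with
propositional variables indexed by `ℕ`. -/
inductive Fml (S : Type) : Type where
  | var (p : ℕ) : Fml S
  | top : Fml S
  | and (A B : Fml S) : Fml S
  | dia (a : S) (A : Fml S) : Fml S

/-- `A.subst p C` is `A[C/p]`. -/
def Fml.subst {S : Type} : Fml S → ℕ → Fml S → Fml S
  | .var q, p, C => if q = p then C else .var q
  | .top, _, _ => .top
  | .and A B, p, C => .and (A.subst p C) (B.subst p C)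
  | .dia a A, p, C => .dia a (A.subst p C)

/-- A formula is variable-free if no propositional variable occurs in it. -/
def Fml.VarFree {S : Type} : Fml S → Prop
  | .var _ => False
  | .top => True
  | .and A B => A.VarFree ∧ B.VarFree
  | .dia _ A => A.VarFree

/-- `Provable Ax A B` : the sequent `A ⊢ B` belongs to the least normal strictly positive logic
containing all the sequents in `Ax`, that is, it is derivable from `Ax` by the axioms and rules
of `K⁺` and the substitution rule. -/
inductive Provable {S : Type} (Ax : Fml S → Fml S → Prop) : Fml S → Fml S → Prop where
  | ax {A B} : Ax A B → Provable Ax A B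
  | refl (A) : Provable Ax A A
  | top (A) : Provable Ax A .top
  | cut {A B C} : Provable Ax A B → Provable Ax B C → Provable Ax A C
  | andLeft (A B) : Provable Ax (.and A B) A
  | andRight (A B) : Provable Ax (.and A B) B
  | andIntro {A B C} : Provable Ax A B → Provable Ax A C → Provable Ax A (.and B C)
  | nec (a : S) {A B} : Provable Ax A B → Provable Ax (.dia a A) (.dia a B)
  | subst (p : ℕ) (C : Fml S) {A B} : Provable Ax A B →
      Provable Ax (A.subst p C) (B.subst p C)

/-- The axioms of reflection calculus stated for a family `d 0, d 1, …` of modalities. -/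
inductive RCAxiom {S : Type} (d : ℕ → S) : Fml S → Fml S → Prop where
  | trans (n : ℕ) (A) : RCAxiom d (.dia (d n) (.dia (d n) A)) (.dia (d n) A)
  | mono {m n : ℕ} (h : m < n) (A) : RCAxiom d (.dia (d n) A) (.dia (d m) A)
  | six {m n : ℕ} (h : m < n) (A B) :
      RCAxiom d (.and (.dia (d n) A) (.dia (d m) B)) (.dia (d n) (.and A (.dia (d m) B)))

/-- The reflection calculus `RC`, in the signature `{◇ₙ : n ∈ ω}`. -/
def RC : Fml ℕ → Fml ℕ → Prop := Provable (RCAxiom id)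

/-- The signature `{◇ₙ, ∇ₙ : n ∈ ω}`. -/
inductive Mod : Type where
  | dia (n : ℕ) : Mod
  | nab (n : ℕ) : Mod

/-- The axioms of the system `RC^∇`. -/
inductive RCNAxiom : Fml Mod → Fml Mod → Prop where
  | rcDia {A B} : RCAxiom Mod.dia A B → RCNAxiom A B
  | rcNab {A B} : RCAxiom Mod.nab A B → RCNAxiom A B
  | nabIntro (n : ℕ) (A) : RCNAxiom A (.dia (.nab n) A)
  | diaNab (n : ℕ) (A) : RCNAxiom (.dia (.dia n) A) (.dia (.nab n) A)
  | diaAbsorb {m n : ℕ} (h : m ≤ n) (A) :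
      RCNAxiom (.dia (.dia m) (.dia (.nab n) A)) (.dia (.dia m) A)
  | nabAbsorb {m n : ℕ} (h : m ≤ n) (A) :
      RCNAxiom (.dia (.nab n) (.dia (.dia m) A)) (.dia (.dia m) A)

/-- The system `RC^∇`. -/
def RCN : Fml Mod → Fml Mod → Prop := Provable RCNAxiom

/-- Variable-free strictly positive formulas. -/
abbrev CFml (S : Type) : Type := {A : Fml S // A.VarFree}

namespace CFml

variable {S : Type}

/-- The constant `⊤`. -/
def top : CFml S := ⟨.top, trivial⟩

/-- Conjunction. -/
def and (A B : CFml S) : CFml S := ⟨.and A.1 B.1, A.2, B.2⟩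

/-- Application of a modality. -/
def dia (a : S) (A : CFml S) : CFml S := ⟨.dia a A.1, A.2⟩

/-- The conjunction of a finite list of formulas; the empty conjunction is `⊤`. -/
def conj : List (CFml S) → CFml S
  | [] => top
  | A :: l => and A (conj l)

end CFml

/-! ## Algebras in the signature `∧, ◇ₙ, ∇ₙ` and their isomorphisms -/

/-- The operations `∧`, `◇ₙ`, `∇ₙ` on a set. -/
class NabOps (X : Type*) where
  meet : X → X → X
  dia : ℕ → X → X
  nab : ℕ → X → X

/-- An isomorphism: a bijection that preserves all the operations. -/
structure NabIso (X Y : Type*) [NabOps X] [NabOps Y] extends X ≃ Y where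
  map_meet : ∀ x y : X, toFun (NabOps.meet x y) = NabOps.meet (toFun x) (toFun y)
  map_dia : ∀ (n : ℕ) (x : X), toFun (NabOps.dia n x) = NabOps.dia n (toFun x)
  map_nab : ∀ (n : ℕ) (x : X), toFun (NabOps.nab n x) = NabOps.nab n (toFun x)

/-! ## The Lindenbaum–Tarski algebra of the variable-free fragment of `RC^∇` -/

/-- Provable equivalence of variable-free formulas in `RC^∇`. -/
def rcnSetoid : Setoid (CFml Mod) where
  r A B := RCN A.1 B.1 ∧ RCN B.1 A.1
  iseqv :=
    { refl := fun _ => ⟨.refl _, .refl _⟩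
      symm := fun h => ⟨h.2, h.1⟩
      trans := fun h k => ⟨.cut h.1 k.1, .cut k.2 h.2⟩ }

/-- The set of variable-free formulas of `RC^∇` modulo provable equivalence. -/
def LTAlg : Type := Quotient rcnSetoid

theorem and_mono {S : Type} {Ax : Fml S → Fml S → Prop} {A A' B B' : Fml S}
    (h : Provable Ax A A') (k : Provable Ax B B') :
    Provable Ax (.and A B) (.and A' B') :=
  .andIntro (.cut (.andLeft _ _) h) (.cut (.andRight _ _) k)

instance : NabOps LTAlg where
  meet := Quotient.map₂ CFml.and fun _ _ h _ _ k =>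
    ⟨and_mono h.1 k.1, and_mono h.2 k.2⟩
  dia n := Quotient.map (CFml.dia (.dia n)) fun _ _ h => ⟨.nec _ h.1, .nec _ h.2⟩
  nab n := Quotient.map (CFml.dia (.nab n)) fun _ _ h => ⟨.nec _ h.1, .nec _ h.2⟩

/-! ## The Ignatiev frame and the Ignatiev algebra -/

/-- `ell β` is `0` if `β = 0`, and is the unique `γ` such that `β = δ + ω ^ γ` for some `δ`,
otherwise. (The infimum of the empty set of ordinals is `0`.) -/
def ell (β : Ordinal.{0}) : Ordinal.{0} := sInf {γ | ∃ δ, β = δ + ω ^ γ}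

theorem opow_unique {δ δ' γ γ' : Ordinal.{0}} (h : δ + ω ^ γ = δ' + ω ^ γ') : γ = γ' := by
  have key : ∀ {δ δ' γ γ' : Ordinal.{0}}, δ + ω ^ γ = δ' + ω ^ γ' → γ' ≤ γ := by
    intro δ δ' γ γ' h
    by_contra! hlt
    have hpow : (ω : Ordinal.{0}) ^ γ < ω ^ γ' := (opow_lt_opow_iff_right one_lt_omega0).2 hlt
    rcases le_total δ δ' with hd | hd
    · obtain ⟨ρ, rfl⟩ := exists_add_of_le hd
      rw [add_assoc] at h
      have h' := add_left_cancel h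
      exact absurd (h' ▸ (le_add_self : ω ^ γ' ≤ ρ + ω ^ γ')) (not_le.2 hpow)
    · obtain ⟨ρ, rfl⟩ := exists_add_of_le hd
      rw [add_assoc] at h
      have h' := add_left_cancel h
      rcases lt_or_ge ρ (ω ^ γ') with hr | hr
      · exact absurd h' (isPrincipal_add_omega0_opow γ' hr hpow).ne
      · have : ω ^ γ' < ω ^ γ' + ω ^ γ :=
          lt_add_of_pos_right _ (opow_pos _ omega0_pos)
        exact absurd h' (this.trans_le (by gcongr)).ne'
  exact le_antisymm (key h.symm) (key h)

theorem ell_zero : ell 0 = 0 := by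
  have : {γ : Ordinal.{0} | ∃ δ, (0 : Ordinal.{0}) = δ + ω ^ γ} = ∅ := by
    ext γ
    simp only [Set.mem_ofPred_eq, Set.mem_empty_iff_false, iff_false, not_exists]
    intro δ h
    exact absurd h ((opow_pos γ omega0_pos).trans_le le_add_self).ne
  rw [ell, this, Ordinal.sInf_empty]

theorem ell_add_opow (δ γ : Ordinal.{0}) : ell (δ + ω ^ γ) = γ := by
  have : {γ' : Ordinal.{0} | ∃ δ', δ + ω ^ γ = δ' + ω ^ γ'} = {γ} := by
    ext γ'
    constructor
    · rintro ⟨δ', h⟩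
      exact (opow_unique h).symm
    · rintro rfl
      exact ⟨δ, rfl⟩
  rw [ell, this, csInf_singleton]

theorem ell_opow (γ : Ordinal.{0}) : ell (ω ^ γ) = γ := by
  simpa using ell_add_opow 0 γ

theorem exists_eq_add_opow (β : Ordinal.{0}) (hβ : β ≠ 0) : ∃ δ γ : Ordinal.{0}, β = δ + ω ^ γ := by
  induction β using WellFoundedLT.induction with
  | ind β ih =>
    have hle : ω ^ log ω β ≤ β := opow_log_le_self ω hβ
    by_cases h0 : β % ω ^ log ω β = 0
    · have hdiv := Ordinal.div_add_mod β (ω ^ log ω β)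
      rw [h0, add_zero] at hdiv
      obtain ⟨k, hk⟩ := lt_omega0.1 (div_opow_log_lt β one_lt_omega0)
      rw [hk] at hdiv
      cases k with
      | zero => exact absurd (by simpa using hdiv.symm) hβ
      | succ k =>
        refine ⟨ω ^ log ω β * k, log ω β, ?_⟩
        conv_lhs => rw [← hdiv]
        push_cast
        rw [mul_add, mul_one]
    · obtain ⟨δ, γ, h⟩ := ih _ ((mod_lt β (opow_pos _ omega0_pos).ne').trans_le hle) h0
      refine ⟨ω ^ log ω β * (β / ω ^ log ω β) + δ, γ, ?_⟩
      rw [add_assoc, ← h, Ordinal.div_add_mod]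

/-- The set `I` of points of the Ignatiev frame. -/
@[ext]
structure Ign : Type 1 where
  seq : ℕ → Ordinal.{0}
  lt_eps : ∀ i, seq i < ε₀
  step : ∀ i, seq (i + 1) ≤ ell (seq i)

/-- The relation `Rₙ` on the Ignatiev frame. -/
def Ign.R (n : ℕ) (α β : Ign) : Prop :=
  (∀ i < n, α.seq i = β.seq i) ∧ β.seq n < α.seq n

/-- The order `α ≤ β` iff `βₙ ≤ αₙ` for all `n`. -/
instance : PartialOrder Ign where
  le α β := ∀ n, β.seq n ≤ α.seq n
  le_refl _ _ := le_rfl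
  le_trans _ _ _ h k n := (k n).trans (h n)
  le_antisymm _ _ h k := Ign.ext (funext fun n => le_antisymm (k n) (h n))

/-- The coordinatewise infimum of a nonempty set of points of `I`. -/
def Ign.inf (s : Set Ign) (hs : s.Nonempty) : Ign where
  seq i := sInf ((fun γ : Ign => γ.seq i) '' s)
  lt_eps i := by
    obtain ⟨γ, _, h⟩ := csInf_mem (hs.image fun γ : Ign => γ.seq i)
    rw [← h]
    exact γ.lt_eps i
  step i := by
    obtain ⟨γ, hγ, h⟩ := csInf_mem (hs.image fun γ : Ign => γ.seq i)
    rw [← h]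
    exact le_trans (csInf_le' (Set.mem_image_of_mem _ hγ)) (γ.step i)

theorem opow_lt_eps {a : Ordinal.{0}} (h : a < ε₀) : ω ^ a < ε₀ := by
  rw [← omega0_opow_epsilon 0]
  exact (opow_lt_opow_iff_right one_lt_omega0).2 h

theorem add_lt_eps {a b : Ordinal.{0}} (ha : a < ε₀) (hb : b < ε₀) : a + b < ε₀ := by
  have h := isPrincipal_add_omega0_opow (ε₀ : Ordinal.{0})
  rw [omega0_opow_epsilon] at h
  exact h ha hb

theorem lt_opow_of_lt_eps {a : Ordinal.{0}} (h : a < ε₀) : a < ω ^ a :=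
  not_le.1 fun h' => (epsilon_zero_le_of_omega0_opow_le h').not_gt h

theorem ell_lt {a : Ordinal.{0}} (h : a < ε₀) (h0 : a ≠ 0) : ell a < a := by
  obtain ⟨δ, γ, rfl⟩ := exists_eq_add_opow a h0
  rw [ell_add_opow]
  have hle : ω ^ γ ≤ δ + ω ^ γ := le_add_self
  have : γ < ε₀ := (right_le_opow γ one_lt_omega0).trans_lt (hle.trans_lt h)
  exact (lt_opow_of_lt_eps this).trans_le hle

theorem ell_le {a : Ordinal.{0}} (h : a < ε₀) : ell a ≤ a := by
  rcases eq_or_ne a 0 with rfl | h0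
  · exact ell_zero.le
  · exact (ell_lt h h0).le

theorem Ign.seq_le_zero (α : Ign) (i : ℕ) : α.seq i ≤ α.seq 0 := by
  induction i with
  | zero => exact le_rfl
  | succ i ih => exact ((α.step i).trans (ell_le (α.lt_eps i))).trans ih

theorem Ign.eventually_zero (α : Ign) : ∃ N, ∀ i, N ≤ i → α.seq i = 0 := by
  have hz : ∃ N, α.seq N = 0 := by
    by_contra! h
    obtain ⟨x, ⟨N, rfl⟩, hx⟩ := WellFounded.has_min (wellFounded_lt (α := Ordinal.{0}))
      (Set.range α.seq) (Set.range_nonempty _)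
    exact hx _ ⟨N + 1, rfl⟩ ((α.step N).trans_lt (ell_lt (α.lt_eps N) (h N)))
  obtain ⟨N, hN⟩ := hz
  refine ⟨N, fun i hi => ?_⟩
  induction i, hi using Nat.le_induction with
  | base => exact hN
  | succ i _ ih =>
    have := α.step i
    rw [ih, ell_zero] at this
    exact le_antisymm this zero_le

/-- The sequence `(ω_k(μ), …, ω^μ, μ, 0, 0, …)` with the entry `μ` in position `k`. -/
def towerSeq (μ : Ordinal.{0}) : ℕ → ℕ → Ordinal.{0}
  | 0, 0 => μ
  | 0, _ + 1 => 0
  | k + 1, 0 => ω ^ towerSeq μ k 0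
  | k + 1, i + 1 => towerSeq μ k i

theorem towerSeq_lt (μ : Ordinal.{0}) (hμ : μ < ε₀) (k i : ℕ) : towerSeq μ k i < ε₀ := by
  induction k generalizing i with
  | zero => cases i with
    | zero => exact hμ
    | succ i => exact epsilon_pos 0
  | succ k ih => cases i with
    | zero => exact opow_lt_eps (ih 0)
    | succ i => exact ih i

theorem towerSeq_step (μ : Ordinal.{0}) (k i : ℕ) :
    towerSeq μ k (i + 1) ≤ ell (towerSeq μ k i) := by
  induction k generalizing i with
  | zero => exact zero_le
  | succ k ih => cases i with
    | zero => exact (ell_opow _).ge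
    | succ i => exact ih i

theorem le_towerSeq (μ : Ordinal.{0}) (k i : ℕ) (h : i ≤ k) : μ ≤ towerSeq μ k i := by
  induction k generalizing i with
  | zero =>
    obtain rfl : i = 0 := by omega
    exact le_rfl
  | succ k ih => cases i with
    | zero => exact (ih 0 (by omega)).trans (right_le_opow _ one_lt_omega0)
    | succ i => exact ih i (by omega)

/-- Any two points of `I` have a common lower bound. -/
theorem Ign.exists_lower (α β : Ign) : ({γ : Ign | γ ≤ α ∧ γ ≤ β}).Nonempty := by
  obtain ⟨M, hM⟩ := α.eventually_zero
  obtain ⟨N, hN⟩ := β.eventually_zero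
  have hμ : max (α.seq 0) (β.seq 0) < ε₀ := max_lt (α.lt_eps 0) (β.lt_eps 0)
  refine ⟨⟨towerSeq (max (α.seq 0) (β.seq 0)) (max M N), towerSeq_lt _ hμ _,
    towerSeq_step _ _⟩, fun i => ?_, fun i => ?_⟩
  · rcases le_total i (max M N) with h | h
    · exact ((α.seq_le_zero i).trans (le_max_left _ _)).trans (le_towerSeq _ _ _ h)
    · rw [hM i (le_trans (le_max_left _ _) h)]
      exact zero_le
  · rcases le_total i (max M N) with h | h
    · exact ((β.seq_le_zero i).trans (le_max_right _ _)).trans (le_towerSeq _ _ _ h)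
    · rw [hN i (le_trans (le_max_right _ _) h)]
      exact zero_le

/-- `I` is a meet-semilattice. -/
instance : SemilatticeInf Ign where
  inf α β := Ign.inf {γ | γ ≤ α ∧ γ ≤ β} (Ign.exists_lower α β)
  inf_le_left α β n :=
    le_csInf ((Ign.exists_lower α β).image _) (by rintro _ ⟨γ, hγ, rfl⟩; exact hγ.1 n)
  inf_le_right α β n :=
    le_csInf ((Ign.exists_lower α β).image _) (by rintro _ ⟨γ, hγ, rfl⟩; exact hγ.2 n)
  le_inf γ _ _ h k _ := csInf_le' ⟨γ, ⟨h, k⟩, rfl⟩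

/-- The truncation `(α₀, …, αₙ, 0, 0, …)`. -/
def Ign.nab (n : ℕ) (α : Ign) : Ign where
  seq i := if i ≤ n then α.seq i else 0
  lt_eps i := by
    split_ifs
    · exact α.lt_eps i
    · exact epsilon_pos 0
  step i := by
    by_cases h : i + 1 ≤ n
    · rw [if_pos h, if_pos (by omega)]
      exact α.step i
    · rw [if_neg h]
      exact zero_le

/-- `diaSeq a k i` is the entry `β_i` of the sequence with `β_{i+k} = 0` and
`β_j = a_j + ω ^ β_{j+1}` for `i ≤ j < i + k`. -/
def diaSeq (a : ℕ → Ordinal.{0}) : ℕ → ℕ → Ordinal.{0}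
  | 0, _ => 0
  | k + 1, i => a i + ω ^ diaSeq a k (i + 1)

/-- `◇ₙ(α) = (β₀, …, βₙ, 0, 0, …)`, where `β_{n+1} = 0` and `β_i = α_i + ω ^ β_{i+1}` for
`i ≤ n`. -/
def Ign.dia (n : ℕ) (α : Ign) : Ign where
  seq i := diaSeq α.seq (n + 1 - i) i
  lt_eps i := by
    generalize n + 1 - i = k
    induction k generalizing i with
    | zero => exact epsilon_pos 0
    | succ k ih => exact add_lt_eps (α.lt_eps i) (opow_lt_eps (ih (i + 1)))
  step i := by
    rcases le_or_gt i n with h | h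
    · have h1 : n + 1 - i = (n + 1 - (i + 1)) + 1 := by omega
      rw [h1, diaSeq, ell_add_opow]
    · have h1 : n + 1 - (i + 1) = 0 := by omega
      rw [h1, diaSeq]
      exact zero_le

/-- The Ignatiev `RC^∇`-algebra. -/
instance : NabOps Ign where
  meet α β := α ⊓ β
  dia := Ign.dia
  nab := Ign.nab

/-! ## Bounded variable-free `RC`-theories -/

/-- `T` is an `RC`-theory (in the variable-free language): `B ∈ T` whenever `A₁, …, Aₖ ∈ T` and
`A₁ ∧ … ∧ Aₖ ⊢ B` in `RC`. -/
def IsTheory (T : Set (CFml ℕ)) : Prop :=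
  ∀ (l : List (CFml ℕ)) (B : CFml ℕ), (∀ A ∈ l, A ∈ T) → RC (CFml.conj l).1 B.1 → B ∈ T

/-- `T` is bounded: all its elements follow from a single variable-free formula. -/
def IsBounded (T : Set (CFml ℕ)) : Prop := ∃ A : CFml ℕ, T ⊆ {B | RC A.1 B.1}

/-- The theory generated (axiomatized) by a set of formulas: the least theory containing it. -/
def gen (X : Set (CFml ℕ)) : Set (CFml ℕ) := {B | ∀ T, IsTheory T → X ⊆ T → B ∈ T}

theorem isTheory_gen (X : Set (CFml ℕ)) : IsTheory (gen X) :=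
  fun l B hl hB T hT hX => hT l B (fun A hA => hl A hA T hT hX) hB

theorem subset_gen (X : Set (CFml ℕ)) : X ⊆ gen X := fun _ h _ _ hX => hX h

theorem gen_subset {X T : Set (CFml ℕ)} (hT : IsTheory T) (h : X ⊆ T) : gen X ⊆ T :=
  fun _ hA => hA T hT h

theorem isTheory_consequences (A : CFml ℕ) : IsTheory {B | RC A.1 B.1} := by
  intro l B hl hB
  refine Provable.cut ?_ hB
  clear hB
  induction l with
  | nil => exact .top _
  | cons C l ih =>
    exact .andIntro (hl C (by simp)) (ih fun D hD => hl D (by simp [hD]))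

/-- The set of bounded variable-free `RC`-theories. -/
abbrev BTh : Type := {T : Set (CFml ℕ) // IsTheory T ∧ IsBounded T}

/-- Theories generated by a bounded set of formulas. -/
def BTh.gen (X : Set (CFml ℕ)) (hX : IsBounded X) : BTh :=
  ⟨RCNabla.gen X, isTheory_gen X, by
    obtain ⟨A, hA⟩ := hX
    exact ⟨A, gen_subset (isTheory_consequences A) hA⟩⟩

theorem IsBounded.mono {X Y : Set (CFml ℕ)} (hY : IsBounded Y) (h : X ⊆ Y) : IsBounded X := by
  obtain ⟨A, hA⟩ := hY
  exact ⟨A, h.trans hA⟩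

theorem IsBounded.union {X Y : Set (CFml ℕ)} (hX : IsBounded X) (hY : IsBounded Y) :
    IsBounded (X ∪ Y) := by
  obtain ⟨A, hA⟩ := hX
  obtain ⟨B, hB⟩ := hY
  refine ⟨A.and B, ?_⟩
  rintro C (hC | hC)
  · exact .cut (.andLeft _ _) (hA hC)
  · exact .cut (.andRight _ _) (hB hC)

theorem isBounded_singleton (A : CFml ℕ) : IsBounded {A} :=
  ⟨A, by rintro B rfl; exact .refl _⟩

/-- The theory generated by a single formula. -/
def BTh.single (A : CFml ℕ) : BTh := BTh.gen {A} (isBounded_singleton A)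

/-- `T ∧ S` is the theory generated by `T ∪ S`. -/
def BTh.meet (T S : BTh) : BTh := BTh.gen (T.1 ∪ S.1) (T.2.2.union S.2.2)

/-- `∇ₙT` is the theory axiomatized by `{◇ₘA : ◇ₘA ∈ T, m ≤ n}`. -/
def BTh.nab (n : ℕ) (T : BTh) : BTh :=
  BTh.gen {B | B ∈ T.1 ∧ ∃ m ≤ n, ∃ A : CFml ℕ, B = A.dia m}
    (T.2.2.mono fun _ h => h.1)

/-- `IsWord n A` : `A ∈ Wₙ`, that is, `A` is built from `⊤` by the modalities `◇ᵢ`, `i ≥ n`. -/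
inductive IsWord (n : ℕ) : CFml ℕ → Prop where
  | top : IsWord n CFml.top
  | dia {m : ℕ} (h : n ≤ m) {A : CFml ℕ} : IsWord n A → IsWord n (A.dia m)

/-- `T` is of level at least `n`: it is generated by a subset of `Wₙ`. -/
def BTh.LevelGE (n : ℕ) (T : BTh) : Prop :=
  ∃ X : Set (CFml ℕ), (∀ A ∈ X, IsWord n A) ∧ T.1 = RCNabla.gen X

open Classical in
/-- For `T` of level at least `n`: the theory generated by `◇ₙA`, where `A ∈ Wₙ` is such that
`∇ₙA = ∇ₙT`. (The value in the absence of such an `A` is irrelevant.) -/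
def BTh.diaLevel (n : ℕ) (T : BTh) : BTh :=
  if h : ∃ A : CFml ℕ, IsWord n A ∧ BTh.nab n (BTh.single A) = BTh.nab n T then
    BTh.single (h.choose.dia n)
  else T

/-- `Tᵢ` : the theory generated by `T ∩ Wᵢ`. -/
def BTh.part (i : ℕ) (T : BTh) : BTh :=
  BTh.gen {A | A ∈ T.1 ∧ IsWord i A} (T.2.2.mono fun _ h => h.1)

/-- `f 0 ∧ f 1 ∧ … ∧ f n`. -/
def BTh.bigMeet (f : ℕ → BTh) : ℕ → BTh
  | 0 => f 0
  | n + 1 => BTh.meet (BTh.bigMeet f n) (f (n + 1))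

/-- `◇ₙ(T) = ◇₀(T₀) ∧ ◇₁(T₁) ∧ … ∧ ◇ₙ(Tₙ)`. -/
def BTh.dia (n : ℕ) (T : BTh) : BTh :=
  BTh.bigMeet (fun i => BTh.diaLevel i (BTh.part i T)) n

/-- The algebra of bounded variable-free `RC`-theories. -/
instance : NabOps BTh where
  meet := BTh.meet
  dia := BTh.dia
  nab := BTh.nab

/-! ## The algebra of cones of the Ignatiev frame -/

/-- `C_α ∩ I`, the set of points of `I` below the sequence `α`. -/
def coneAt (α : ℕ → Ordinal.{0}) : Set Ign := {β | ∀ i, α i ≤ β.seq i}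

/-- A cone in the Ignatiev frame is a nonempty set `C_α ∩ I`, where `α` is a sequence of
ordinals `≤ ε₀`. -/
def IsCone (C : Set Ign) : Prop :=
  C.Nonempty ∧ ∃ α : ℕ → Ordinal.{0}, (∀ i, α i ≤ ε₀) ∧ C = coneAt α

/-- `Rₙ⁻¹(C)`. -/
def rInv (n : ℕ) (C : Set Ign) : Set Ign := {α | ∃ β ∈ C, Ign.R n α β}

/-- The set of all cones in the Ignatiev frame. -/
abbrev Cone : Type 1 := {C : Set Ign // IsCone C}

/-- A cone is generated by its greatest point, which belongs to `I`. -/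
theorem IsCone.exists_eq {C : Set Ign} (hC : IsCone C) : ∃ δ : Ign, C = coneAt δ.seq := by
  obtain ⟨hne, α, _, rfl⟩ := hC
  refine ⟨Ign.inf _ hne, Set.Subset.antisymm (fun γ hγ i => csInf_le' ⟨γ, hγ, rfl⟩) ?_⟩
  intro γ hγ i
  refine le_trans (le_csInf (hne.image _) ?_) (hγ i)
  rintro _ ⟨β, hβ, rfl⟩
  exact hβ i

/-- An intersection of sets of the form `C_α ∩ I` is of this form. -/
theorem exists_coneAt_iInter {ι : Sort*} (C : ι → Set Ign)
    (h : ∀ j, ∃ α : ℕ → Ordinal.{0}, (∀ i, α i ≤ ε₀) ∧ C j = coneAt α) :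
    ∃ α : ℕ → Ordinal.{0}, (∀ i, α i ≤ ε₀) ∧ (⋂ j, C j) = coneAt α := by
  choose α hα hC using h
  have hb : ∀ i, BddAbove (Set.range fun j => α j i) := fun i =>
    ⟨ε₀, by rintro _ ⟨j, rfl⟩; exact hα j i⟩
  refine ⟨fun i => sSup (Set.range fun j => α j i), fun i => ?_, ?_⟩
  · exact csSup_le' (by rintro _ ⟨j, rfl⟩; exact hα j i)
  · ext γ
    simp only [Set.mem_iInter, hC]
    constructor
    · intro hγ i
      exact csSup_le' (by rintro _ ⟨j, rfl⟩; exact hγ j i)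
    · intro hγ j i
      exact (le_csSup (hb i) ⟨j, rfl⟩).trans (hγ i)

theorem mem_rInv_coneAt (n : ℕ) (δ γ : Ign) :
    γ ∈ rInv n (coneAt δ.seq) ↔ (∀ i < n, δ.seq i ≤ γ.seq i) ∧ δ.seq n < γ.seq n := by
  constructor
  · rintro ⟨β, hβ, h1, h2⟩
    exact ⟨fun i hi => (h1 i hi).symm ▸ hβ i, (hβ n).trans_lt h2⟩
  · rintro ⟨h1, h2⟩
    refine ⟨⟨fun i => if i < n then γ.seq i else δ.seq i, fun i => ?_, fun i => ?_⟩,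
      fun i => ?_, fun i hi => ?_, ?_⟩
    · split_ifs
      · exact γ.lt_eps i
      · exact δ.lt_eps i
    · rcases lt_trichotomy (i + 1) n with h | h | h
      · rw [if_pos h, if_pos (by omega)]
        exact γ.step i
      · rw [if_neg (by omega), if_pos (by omega), h]
        exact h2.le.trans (h ▸ γ.step i)
      · rw [if_neg (by omega), if_neg (by omega)]
        exact δ.step i
    · show δ.seq i ≤ if i < n then γ.seq i else δ.seq i
      split_ifs with h
      · exact h1 i h
      · exact le_rfl
    · exact (if_pos hi).symm
    · show (if n < n then γ.seq n else δ.seq n) < γ.seq n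
      rwa [if_neg (lt_irrefl n)]

theorem exists_coneAt_rInv (n : ℕ) {C : Set Ign} (hC : IsCone C) :
    ∃ α : ℕ → Ordinal.{0}, (∀ i, α i ≤ ε₀) ∧ rInv n C = coneAt α := by
  obtain ⟨δ, rfl⟩ := hC.exists_eq
  refine ⟨fun i => if i < n then δ.seq i else if i = n then Order.succ (δ.seq i) else 0,
    fun i => ?_, ?_⟩
  · show (if i < n then δ.seq i else if i = n then Order.succ (δ.seq i) else 0) ≤ ε₀
    split_ifs
    · exact (δ.lt_eps i).le
    · exact Order.succ_le_of_lt (δ.lt_eps i)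
    · exact zero_le
  · ext γ
    rw [mem_rInv_coneAt]
    constructor
    · rintro ⟨h1, h2⟩ i
      show (if i < n then δ.seq i else if i = n then Order.succ (δ.seq i) else 0) ≤ _
      split_ifs with h h'
      · exact h1 i h
      · subst h'
        exact Order.succ_le_of_lt h2
      · exact zero_le
    · intro h
      refine ⟨fun i hi => ?_, ?_⟩
      · simpa [hi] using h i
      · simpa using h n

theorem lt_dia (n i : ℕ) (h : i ≤ n) (δ : Ign) : δ.seq i < (Ign.dia n δ).seq i := by
  show _ < diaSeq δ.seq (n + 1 - i) i
  rw [show n + 1 - i = (n - i) + 1 by omega, diaSeq]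
  exact lt_add_of_pos_right _ (opow_pos _ omega0_pos)

/-- The intersection of two cones. -/
def Cone.meet (C D : Cone) : Cone :=
  ⟨C.1 ∩ D.1, by
    obtain ⟨γ, hγ⟩ := C.2.exists_eq
    obtain ⟨δ, hδ⟩ := D.2.exists_eq
    refine ⟨?_, ?_⟩
    · obtain ⟨β, h1, h2⟩ := Ign.exists_lower γ δ
      exact ⟨β, hγ.symm ▸ h1, hδ.symm ▸ h2⟩
    · obtain ⟨α, hα, h⟩ := exists_coneAt_iInter (fun b : Bool => if b then C.1 else D.1)
        (by rintro (_ | _); exacts [D.2.2, C.2.2])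
      refine ⟨α, hα, h ▸ ?_⟩
      rw [Set.inter_eq_iInter]
      refine Set.iInter_congr ?_
      rintro (_ | _) <;> rfl⟩

/-- `◇ₙ(C) = ⋂_{i ≤ n} Rᵢ⁻¹(C)`. -/
def Cone.dia (n : ℕ) (C : Cone) : Cone :=
  ⟨⋂ i : {i : ℕ // i ≤ n}, rInv i C.1, by
    obtain ⟨δ, hδ⟩ := C.2.exists_eq
    refine ⟨⟨Ign.dia n δ, Set.mem_iInter.2 ?_⟩,
      exists_coneAt_iInter _ fun i => exists_coneAt_rInv i C.2⟩
    rintro ⟨i, hi⟩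
    rw [hδ, mem_rInv_coneAt]
    exact ⟨fun j hj => (lt_dia n j (hj.le.trans hi) δ).le, lt_dia n i hi δ⟩⟩

/-- `∇ₙ(C)` is the intersection (in `I`) of all the sets `Rᵢ⁻¹(D)` such that `D` is a cone,
`i ≤ n` and `C ⊆ Rᵢ⁻¹(D)`. -/
def Cone.nab (n : ℕ) (C : Cone) : Cone :=
  ⟨⋂ p : {p : Cone × ℕ // p.2 ≤ n ∧ C.1 ⊆ rInv p.2 p.1.1}, rInv p.1.2 p.1.1.1, by
    refine ⟨C.2.1.mono (Set.subset_iInter fun p => p.2.2),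
      exists_coneAt_iInter _ fun p => exists_coneAt_rInv p.1.2 p.1.1.2⟩⟩

/-- The algebra of cones of the Ignatiev frame. -/
instance : NabOps Cone where
  meet := Cone.meet
  dia := Cone.dia
  nab := Cone.nab

end RCNabla

end

/-!
All four structures are compared with the set `I` of points of the Ignatiev frame.

In every algebra satisfying the laws of `RC` there are canonical elements `w_i(a)`, for `a < ε₀`,
with `w_i(0) = ⊤` and `w_i(δ + ω ^ γ) = w_{i+1}(γ) ⊓ ◇_i w_i(δ)` (`canon`). At a fixed level they
are linearly ordered: `w_i(a) ≤ ◇_i w_i(b)` for `b < a` (`IsRCAlg.canon_le_dia`). They are closed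
under meets and under `◇ₙ`, `n ≥ i`. In an algebra with the laws of `RC^∇`, a point `α` of `I` is
sent to the normal form `⋀_i ∇_i w_i(α_i)`, and this map preserves all the operations
(`IsRCNAlg.interp_nab`, `interp_dia`, `interp_inf`). On the other hand `I` satisfies the laws of
`RC^∇`, because `γ ≤ ◇ₙα` means `α_i < γ_i` for all `i ≤ n` (`Ign.le_dia_iff`). There `w_i(a)` is
a point with entry `a` in position `i` and the least possible entries before it, so that
`γ ≤ ∇_i w_i(a)` iff `a ≤ γ_i`, and `γ ≤ ◇_i w_i(a)` iff `a < γ_i`. Hence the normal form of `α`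
has value `α` in `I`, and evaluation and normal form are inverse isomorphisms between the
Lindenbaum–Tarski algebra and `I`.

For `RC` alone, every variable-free formula is equivalent to some `w_0(a)`, and `a` can be read
off from its value in `I`; so `RC` is complete for `I` (`CFml.val_le_val_iff`). A bounded theory is
directed, and the coordinatewise supremum `σ` of the values of its members is again a point of `I`
(`BTh.exists_sup`). The theory consists of the formulas true at `σ`: membership of `w_i(a)` is
shown by induction on `a`, since `σ ≤ ◇_i w_i(δ)` only requires some member of the theory to have
its `i`-th entry above `δ`. Thus `α ↦ {A | α ≤ A.val}` is a bijection from `I` to the bounded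
theories. A theory generated by a set corresponds to the greatest lower bound of the values, which
yields all the operations. For a theory of level at least `n` with point `τ`, the word with value
`w_n(τ_n)` agrees with `τ` up to position `n`, and this shows that `Dₙ` is well defined.

Cones are the principal lower sets of `I`, and the operations on them are computed directly.
-/

noncomputable section

namespace RCNabla

open Ordinal
open scoped Ordinal

/-! ### Last Cantor normal form terms -/

/-- An ordinal above `δ` whose last Cantor normal form term is at least `ω ^ c` is at least
`δ + ω ^ c`. -/
theorem add_opow_le_of_lt {δ x c : Ordinal.{0}} (h : δ < x) (hc : c ≤ ell x) :
    δ + ω ^ c ≤ x := by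
  obtain ⟨ρ, rfl⟩ := exists_add_of_le h.le
  have hρ : ρ ≠ 0 := by
    rintro rfl
    simp at h
  obtain ⟨ρ', γ, rfl⟩ := exists_eq_add_opow ρ hρ
  rw [← add_assoc, ell_add_opow] at hc
  have h1 : (ω : Ordinal.{0}) ^ c ≤ ω ^ γ := (opow_le_opow_iff_right one_lt_omega0).2 hc
  have h2 : (ω : Ordinal.{0}) ^ γ ≤ ρ' + ω ^ γ := le_add_self
  gcongr
  exact h1.trans h2

/-- The ordinal `a` without its last Cantor normal form term `ω ^ ell a`; as `a` has many
representations `δ + ω ^ ell a`, the least such `δ` is taken. -/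
def rem (a : Ordinal.{0}) : Ordinal.{0} := sInf {δ | a = δ + ω ^ ell a}

theorem rem_add_opow_ell {a : Ordinal.{0}} (ha : a ≠ 0) : rem a + ω ^ ell a = a := by
  obtain ⟨δ, γ, h⟩ := exists_eq_add_opow a ha
  have hne : {δ | a = δ + ω ^ ell a}.Nonempty := ⟨δ, by
    show a = δ + ω ^ ell a
    rw [h, ell_add_opow]⟩
  exact (csInf_mem hne).symm

theorem rem_lt {a : Ordinal.{0}} (ha : a ≠ 0) : rem a < a := by
  conv_rhs => rw [← rem_add_opow_ell ha]
  exact lt_add_of_pos_right _ (opow_pos _ omega0_pos)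

theorem rem_add_opow_le (δ γ : Ordinal.{0}) : rem (δ + ω ^ γ) ≤ δ :=
  csInf_le' (by show _ = _; rw [ell_add_opow])

theorem add_opow_ne_zero (δ γ : Ordinal.{0}) : δ + ω ^ γ ≠ 0 :=
  ((opow_pos γ omega0_pos).trans_le le_add_self).ne'

/-- A smaller last term is absorbed by a larger power of `ω` added on the right. -/
theorem rem_add_opow_of_ell_lt {a c : Ordinal.{0}} (ha : a ≠ 0) (h : ell a < c) :
    rem a + ω ^ c = a + ω ^ c := by
  conv_rhs => rw [← rem_add_opow_ell ha]
  rw [add_assoc, add_omega0_opow ((opow_lt_opow_iff_right one_lt_omega0).2 h)]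

theorem opow_le_of_le_ell {a x : Ordinal.{0}} (hx : x ≠ 0) (h : a ≤ ell x) : ω ^ a ≤ x := by
  simpa using add_opow_le_of_lt (pos_iff_ne_zero.2 hx) h

/-! ### Algebras with reflection modalities -/

/-- The laws of the reflection calculus for a family `d 0, d 1, …` of operations on a
meet-semilattice with top. -/
structure IsRCAlg {X : Type*} [SemilatticeInf X] [OrderTop X] (d : ℕ → X → X) : Prop where
  mono : ∀ n, Monotone (d n)
  trans : ∀ n x, d n (d n x) ≤ d n x
  anti : ∀ {m n}, m < n → ∀ x, d n x ≤ d m x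
  six : ∀ {m n}, m < n → ∀ x y, d n x ⊓ d m y ≤ d n (x ⊓ d m y)

/-- The laws of `RC^∇` for a family `d` interpreting the `◇ₙ` and a family `b` interpreting the
`∇ₙ`. -/
structure IsRCNAlg {X : Type*} [SemilatticeInf X] [OrderTop X] (d b : ℕ → X → X) : Prop where
  dia : IsRCAlg d
  nab : IsRCAlg b
  nabIntro : ∀ n x, x ≤ b n x
  diaNab : ∀ n x, d n x ≤ b n x
  diaAbsorb : ∀ {m n}, m ≤ n → ∀ x, d m (b n x) ≤ d m x
  nabAbsorb : ∀ {m n}, m ≤ n → ∀ x, b n (d m x) ≤ d m x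

open Classical in
/-- The canonical element `w_i(a)` of level `i` for the ordinal `a < ε₀`: `w_i(0) = ⊤` and
`w_i(a) = w_{i+1}(γ) ⊓ ◇_i w_i(δ)` for `a = δ + ω ^ γ`. The guard holds for all `0 < a < ε₀`. -/
def canon {X : Type*} [SemilatticeInf X] [OrderTop X] (d : ℕ → X → X) (a : Ordinal.{0}) (i : ℕ) :
    X :=
  if h : ell a < a ∧ rem a < a then canon d (ell a) (i + 1) ⊓ d i (canon d (rem a) i) else ⊤
termination_by a
decreasing_by exacts [h.1, h.2]

section RCAlg

variable {X : Type*} [SemilatticeInf X] [OrderTop X] {d : ℕ → X → X}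

theorem canon_zero (i : ℕ) : canon d 0 i = ⊤ := by
  rw [canon, dif_neg]
  simp

theorem canon_eq {a : Ordinal.{0}} (ha : a < ε₀) (h0 : a ≠ 0) (i : ℕ) :
    canon d a i = canon d (ell a) (i + 1) ⊓ d i (canon d (rem a) i) := by
  rw [canon, dif_pos ⟨ell_lt ha h0, rem_lt h0⟩]

theorem canon_le_ell {a : Ordinal.{0}} (ha : a < ε₀) (i : ℕ) :
    canon d a i ≤ canon d (ell a) (i + 1) := by
  rcases eq_or_ne a 0 with rfl | h0
  · rw [ell_zero, canon_zero, canon_zero]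
  · rw [canon_eq ha h0]
    exact inf_le_left

theorem map_canon {Y : Type*} [SemilatticeInf Y] [OrderTop Y] {e : ℕ → Y → Y} (φ : X → Y)
    (htop : φ ⊤ = ⊤) (hinf : ∀ x y, φ (x ⊓ y) = φ x ⊓ φ y) (hd : ∀ n x, φ (d n x) = e n (φ x))
    (a : Ordinal.{0}) (i : ℕ) : φ (canon d a i) = canon e a i := by
  induction a using WellFoundedLT.induction generalizing i with
  | ind a ih =>
    rw [canon.eq_def d a, canon.eq_def e a]
    split_ifs with h
    · rw [hinf, hd, ih _ h.1, ih _ h.2]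
    · exact htop

theorem ell_lt_eps {a : Ordinal.{0}} (ha : a < ε₀) : ell a < ε₀ := (ell_le ha).trans_lt ha

theorem rem_lt_eps {a : Ordinal.{0}} (ha : a < ε₀) (h0 : a ≠ 0) : rem a < ε₀ :=
  (rem_lt h0).trans ha

namespace IsRCAlg

theorem anti_le (h : IsRCAlg d) {m n : ℕ} (hmn : m ≤ n) (x : X) : d n x ≤ d m x := by
  rcases hmn.eq_or_lt with rfl | hlt
  · exact le_rfl
  · exact h.anti hlt x

theorem comp_le (h : IsRCAlg d) {m n : ℕ} (hmn : m ≤ n) (x : X) : d n (d m x) ≤ d m x :=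
  (h.anti_le hmn _).trans (h.trans m x)

theorem comp_le' (h : IsRCAlg d) {m n : ℕ} (hmn : m ≤ n) (x : X) : d m (d n x) ≤ d m x :=
  (h.mono m (h.anti_le hmn x)).trans (h.trans m x)

theorem map_inf_dia (h : IsRCAlg d) {m n : ℕ} (hmn : m < n) (x y : X) :
    d n (x ⊓ d m y) = d n x ⊓ d m y :=
  le_antisymm
    (le_inf (h.mono n inf_le_left) ((h.mono n inf_le_right).trans (h.comp_le hmn.le y)))
    (h.six hmn x y)

/-- Iteration of the sixth axiom: lower modal conjuncts can be moved under `d n`. -/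
theorem le_map_inf (h : IsRCAlg d) {n : ℕ} {x y : X} {z : ℕ → X} (hx : y ≤ d n x)
    (hz : ∀ i < n, y ≤ d i (z i)) :
    y ≤ d n (x ⊓ (Finset.range n).inf fun i => d i (z i)) := by
  suffices H : ∀ k ≤ n, y ≤ d n (x ⊓ (Finset.range k).inf fun i => d i (z i)) from H n le_rfl
  intro k
  induction k with
  | zero => intro _; simpa using hx
  | succ k ih =>
    intro hk
    rw [Finset.range_add_one, Finset.inf_insert, inf_comm (d k (z k)), ← inf_assoc]
    exact (le_inf (ih (by omega)) (hz k (by omega))).trans (h.six (by omega) _ _)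

/-- The canonical elements of a fixed level are linearly ordered by `x ≤ d i y`. -/
theorem canon_le_dia (h : IsRCAlg d) {a b : Ordinal.{0}} (ha : a < ε₀) (hb : b < a) (i : ℕ) :
    canon d a i ≤ d i (canon d b i) := by
  induction a using WellFoundedLT.induction generalizing b i with
  | ind a iha =>
    induction b using WellFoundedLT.induction with
    | ind b ihb =>
      have h0 : a ≠ 0 := (zero_le.trans_lt hb).ne'
      have hrem : canon d a i ≤ d i (canon d (rem a) i) := by
        rw [canon_eq ha h0]; exact inf_le_right
      rcases lt_trichotomy b (rem a) with hlt | rfl | hlt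
      · exact hrem.trans ((h.mono i (iha _ (rem_lt h0) (rem_lt_eps ha h0) hlt i)).trans
          (h.trans i _))
      · exact hrem
      · have hb0 : b ≠ 0 := (zero_le.trans_lt hlt).ne'
        have hell : ell b < ell a := by
          by_contra! hle
          have := add_opow_le_of_lt hlt hle
          rw [rem_add_opow_ell h0] at this
          exact absurd hb (not_lt.2 this)
        have h1 : canon d a i ≤ d (i + 1) (canon d (ell b) (i + 1)) :=
          (canon_le_ell ha i).trans (iha _ (ell_lt ha h0) (ell_lt_eps ha) hell (i + 1))
        have h2 := ihb _ (rem_lt hb0) ((rem_lt hb0).trans hb)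
        rw [canon_eq (hb.trans ha) hb0]
        exact ((le_inf h1 h2).trans (h.six (Nat.lt_succ_self i) _ _)).trans
          (h.anti (Nat.lt_succ_self i) _)

theorem dia_canon_le (h : IsRCAlg d) {a b : Ordinal.{0}} (ha : a < ε₀) (hb : b ≤ a) (i : ℕ) :
    d i (canon d a i) ≤ d i (canon d b i) := by
  rcases hb.eq_or_lt with rfl | hlt
  · exact le_rfl
  · exact (h.mono i (h.canon_le_dia ha hlt i)).trans (h.trans i _)

/-- The recursive equation of the canonical elements holds for arbitrary, not necessarily
normal, sums `a + ω ^ c`. -/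
theorem canon_add_opow (h : IsRCAlg d) {a c : Ordinal.{0}} (hac : a + ω ^ c < ε₀) (i : ℕ) :
    canon d (a + ω ^ c) i = canon d c (i + 1) ⊓ d i (canon d a i) := by
  have hlt : a < a + ω ^ c := lt_add_of_pos_right _ (opow_pos _ omega0_pos)
  apply le_antisymm
  · refine le_inf ?_ (h.canon_le_dia hac hlt i)
    simpa [ell_add_opow] using canon_le_ell (d := d) hac i
  · rw [canon_eq hac (add_opow_ne_zero a c), ell_add_opow]
    exact inf_le_inf_left _ (h.dia_canon_le (hlt.trans hac) (rem_add_opow_le a c) i)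

theorem canon_opow (h : IsRCAlg d) {c : Ordinal.{0}} (hc : c < ε₀) (h0 : c ≠ 0) (i : ℕ) :
    canon d (ω ^ c) i = canon d c (i + 1) := by
  have := h.canon_add_opow (a := 0) (c := c) (by simpa using opow_lt_eps hc) i
  rw [zero_add] at this
  rw [this, inf_eq_left, canon_zero]
  refine (h.canon_le_dia hc (pos_iff_ne_zero.2 h0) (i + 1)).trans ?_
  rw [canon_zero]
  exact h.anti (Nat.lt_succ_self i) _

theorem canon_add_one (h : IsRCAlg d) {a : Ordinal.{0}} (ha : a < ε₀) (i : ℕ) :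
    canon d (a + 1) i = d i (canon d a i) := by
  have := h.canon_add_opow (a := a) (c := 0)
    (add_lt_eps ha (by simpa using opow_lt_eps (epsilon_pos 0))) i
  rwa [opow_zero, canon_zero, top_inf_eq] at this

theorem exists_canon_succ_level (h : IsRCAlg d) {a : Ordinal.{0}} (ha : a < ε₀) (i : ℕ) :
    ∃ e < ε₀, canon d e i = canon d a (i + 1) := by
  rcases eq_or_ne a 0 with rfl | h0
  · exact ⟨0, ha, by rw [canon_zero, canon_zero]⟩
  · exact ⟨ω ^ a, opow_lt_eps ha, h.canon_opow ha h0 i⟩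

theorem exists_canon_inf (h : IsRCAlg d) {a b : Ordinal.{0}} (ha : a < ε₀) (hb : b < ε₀) (i : ℕ) :
    ∃ e < ε₀, canon d e i = canon d a i ⊓ canon d b i := by
  induction a using WellFoundedLT.induction generalizing b i with
  | ind a ih =>
    rcases eq_or_ne a 0 with rfl | ha0
    · exact ⟨b, hb, by rw [canon_zero, top_inf_eq]⟩
    rcases eq_or_ne b 0 with rfl | hb0
    · exact ⟨a, ha, by rw [canon_zero, inf_top_eq]⟩
    obtain ⟨e, he, hE⟩ := ih _ (ell_lt ha ha0) (ell_lt_eps ha) (ell_lt_eps hb) (i + 1)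
    have hr := rem_lt_eps ha ha0
    have hs := rem_lt_eps hb hb0
    refine ⟨max (rem a) (rem b) + ω ^ e, add_lt_eps (max_lt hr hs) (opow_lt_eps he), ?_⟩
    have hmax : d i (canon d (max (rem a) (rem b)) i) =
        d i (canon d (rem a) i) ⊓ d i (canon d (rem b) i) := by
      rcases le_total (rem a) (rem b) with hle | hle
      · rw [max_eq_right hle, right_eq_inf]
        exact h.dia_canon_le hs hle i
      · rw [max_eq_left hle, left_eq_inf]
        exact h.dia_canon_le hr hle i
    rw [h.canon_add_opow (add_lt_eps (max_lt hr hs) (opow_lt_eps he)), hE, hmax,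
      canon_eq ha ha0, canon_eq hb hb0, inf_inf_inf_comm]

theorem exists_canon_dia (h : IsRCAlg d) {a : Ordinal.{0}} (ha : a < ε₀) {i n : ℕ} (hin : i ≤ n) :
    ∃ e < ε₀, canon d e i = d n (canon d a i) := by
  obtain ⟨k, rfl⟩ := Nat.exists_eq_add_of_le hin
  clear hin
  induction k generalizing a i with
  | zero =>
    exact ⟨a + 1, add_lt_eps ha (by simpa using opow_lt_eps (epsilon_pos 0)),
      h.canon_add_one ha i⟩
  | succ k ih =>
    rw [show i + (k + 1) = i + 1 + k by omega]
    rcases eq_or_ne a 0 with rfl | h0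
    · obtain ⟨e, he, hE⟩ := ih (i := i + 1) ha
      obtain ⟨f, hf, hF⟩ := h.exists_canon_succ_level he i
      exact ⟨f, hf, by rw [hF, hE, canon_zero, canon_zero]⟩
    · obtain ⟨e, he, hE⟩ := ih (i := i + 1) (ell_lt_eps ha)
      have hlt := add_lt_eps (rem_lt_eps ha h0) (opow_lt_eps he)
      refine ⟨rem a + ω ^ e, hlt, ?_⟩
      rw [h.canon_add_opow hlt, hE, canon_eq ha h0, h.map_inf_dia (by omega)]

end IsRCAlg

end RCAlg

/-! ### Points of the Ignatiev frame -/

instance : OrderTop Ign where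
  top := ⟨fun _ => 0, fun _ => epsilon_pos 0, fun _ => zero_le⟩
  le_top _ _ := zero_le

theorem Ign.le_def {α β : Ign} : α ≤ β ↔ ∀ i, β.seq i ≤ α.seq i := Iff.rfl

theorem Ign.top_seq (i : ℕ) : (⊤ : Ign).seq i = 0 := rfl

theorem Ign.nab_seq (n : ℕ) (α : Ign) (i : ℕ) :
    (Ign.nab n α).seq i = if i ≤ n then α.seq i else 0 := rfl

theorem Ign.le_nab_iff {n : ℕ} {α γ : Ign} :
    γ ≤ Ign.nab n α ↔ ∀ i ≤ n, α.seq i ≤ γ.seq i := by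
  rw [Ign.le_def]
  refine ⟨fun h i hi => by simpa [Ign.nab_seq, hi] using h i, fun h i => ?_⟩
  rw [Ign.nab_seq]
  split_ifs with hi
  exacts [h i hi, zero_le]

theorem Ign.le_dia_iff {n : ℕ} {α γ : Ign} :
    γ ≤ Ign.dia n α ↔ ∀ i ≤ n, α.seq i < γ.seq i := by
  refine ⟨fun h i hi => (lt_dia n i hi α).trans_le (h i), fun h i => ?_⟩
  show diaSeq α.seq (n + 1 - i) i ≤ γ.seq i
  generalize hk : n + 1 - i = k
  induction k generalizing i with
  | zero => exact zero_le
  | succ k ih =>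
    exact add_opow_le_of_lt (h i (by omega)) ((ih (i + 1) (by omega)).trans (γ.step i))

/-- Points of the frame can be built by recursion from an index `k` down to `0`, given a point
to supply the coordinates from `k` on. -/
theorem Ign.exists_downward (f : ℕ → Ordinal.{0} → Ordinal.{0}) (k : ℕ)
    (hf : ∀ i < k, ∀ x < ε₀, f i x < ε₀ ∧ x ≤ ell (f i x)) (α : Ign) :
    ∃ δ : Ign, (∀ i, k ≤ i → δ.seq i = α.seq i) ∧ ∀ i < k, δ.seq i = f i (δ.seq (i + 1)) := by
  induction k generalizing f α with
  | zero => exact ⟨α, fun _ _ => rfl, fun _ h => absurd h (Nat.not_lt_zero _)⟩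
  | succ k ih =>
    obtain ⟨δ, h1, h2⟩ := ih (fun i => f (i + 1)) (fun i hi => hf (i + 1) (by omega))
      ⟨fun i => α.seq (i + 1), fun i => α.lt_eps _, fun i => α.step _⟩
    have h0 := hf 0 (by omega) _ (δ.lt_eps 0)
    refine ⟨⟨fun i => match i with | 0 => f 0 (δ.seq 0) | i + 1 => δ.seq i,
      fun i => ?_, fun i => ?_⟩, fun i hi => ?_, fun i hi => ?_⟩
    · cases i with
      | zero => exact h0.1
      | succ i => exact δ.lt_eps i
    · cases i with
      | zero => exact h0.2
      | succ i => exact δ.step i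
    · cases i with
      | zero => omega
      | succ i => exact h1 i (by omega)
    · cases i with
      | zero => rfl
      | succ i => exact h2 i (by omega)

/-- Gluing the coordinates of `γ` below `n` and those of `δ` from `n` on. -/
theorem Ign.exists_splice (n : ℕ) (γ δ : Ign)
    (h : ∀ k, k + 1 = n → δ.seq n ≤ ell (γ.seq k)) :
    ∃ η : Ign, (∀ i < n, η.seq i = γ.seq i) ∧ ∀ i, n ≤ i → η.seq i = δ.seq i := by
  refine ⟨⟨fun i => if i < n then γ.seq i else δ.seq i, fun i => ?_, fun i => ?_⟩,
    fun i hi => if_pos hi, fun i hi => if_neg (by omega)⟩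
  · split_ifs
    exacts [γ.lt_eps i, δ.lt_eps i]
  · rcases lt_trichotomy (i + 1) n with hi | hi | hi
    · rw [if_pos hi, if_pos (by omega)]
      exact γ.step i
    · rw [if_neg (by omega), if_pos (by omega), hi]
      exact h i hi
    · rw [if_neg (by omega), if_neg (by omega)]
      exact δ.step i

theorem Ign.exists_splice_of_le (n : ℕ) (γ δ : Ign) (h : δ.seq n ≤ γ.seq n) :
    ∃ η : Ign, (∀ i < n, η.seq i = γ.seq i) ∧ ∀ i, n ≤ i → η.seq i = δ.seq i :=
  Ign.exists_splice n γ δ fun k hk => h.trans (hk ▸ γ.step k)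

/-- The point with entry `μ` in position `k` and least possible nonzero entries below it. -/
def Ign.tower (μ : Ordinal.{0}) (hμ : μ < ε₀) (k : ℕ) : Ign :=
  ⟨towerSeq μ k, towerSeq_lt μ hμ k, towerSeq_step μ k⟩

theorem towerSeq_self (μ : Ordinal.{0}) (k : ℕ) : towerSeq μ k k = μ := by
  induction k with
  | zero => rfl
  | succ k ih => exact ih

theorem towerSeq_of_lt (μ : Ordinal.{0}) {k i : ℕ} (h : i < k) :
    towerSeq μ k i = ω ^ towerSeq μ k (i + 1) := by
  induction k generalizing i with
  | zero => omega
  | succ k ih => cases i with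
    | zero => rfl
    | succ i => exact ih (by omega)

theorem Ign.opow_seq_le (γ : Ign) {i : ℕ} (h : γ.seq (i + 1) ≠ 0) :
    ω ^ γ.seq (i + 1) ≤ γ.seq i := by
  refine opow_le_of_le_ell ?_ (γ.step i)
  intro h0
  have := γ.step i
  rw [h0, ell_zero] at this
  exact h (le_antisymm this zero_le)

theorem Ign.towerSeq_lt_of_lt {γ : Ign} {k : ℕ} {μ : Ordinal.{0}} (h : μ < γ.seq k) {i : ℕ}
    (hi : i ≤ k) : towerSeq μ k i < γ.seq i := by
  induction hi using Nat.decreasingInduction with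
  | self => rwa [towerSeq_self]
  | of_succ i hi ih =>
    rw [towerSeq_of_lt μ hi]
    exact ((opow_lt_opow_iff_right one_lt_omega0).2 ih).trans_le
      (γ.opow_seq_le (zero_le.trans_lt ih).ne')

theorem Ign.towerSeq_le_of_le {γ : Ign} {k : ℕ} {μ : Ordinal.{0}} (h0 : μ ≠ 0)
    (h : μ ≤ γ.seq k) {i : ℕ} (hi : i ≤ k) : towerSeq μ k i ≤ γ.seq i := by
  induction hi using Nat.decreasingInduction with
  | self => rwa [towerSeq_self]
  | of_succ i hi ih =>
    rw [towerSeq_of_lt μ hi]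
    refine ((opow_le_opow_iff_right one_lt_omega0).2 ih).trans (γ.opow_seq_le ?_)
    exact ((pos_iff_ne_zero.2 h0).trans_le ((le_towerSeq μ k (i + 1) hi).trans ih)).ne'

/-! ### The Ignatiev algebra satisfies the laws of `RC^∇` -/

theorem Ign.isRCAlg_nab : IsRCAlg Ign.nab where
  mono n α β h := Ign.le_nab_iff.2 fun i hi => by simpa [Ign.nab_seq, hi] using h i
  trans n α := Ign.le_nab_iff.2 fun i hi => by simp [Ign.nab_seq, hi]
  anti h α := Ign.le_nab_iff.2 fun i hi => by simp [Ign.nab_seq, hi.trans h.le]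
  six {m n} hmn α β := by
    set γ := Ign.nab n α ⊓ Ign.nab m β with hγ
    have h1 := Ign.le_nab_iff.1 (inf_le_left : γ ≤ Ign.nab n α)
    have h2 := Ign.le_nab_iff.1 (inf_le_right : γ ≤ Ign.nab m β)
    obtain ⟨η, h3, h4⟩ := Ign.exists_splice_of_le n γ α (h1 n le_rfl)
    have hα : η ≤ α := fun i => by
      rcases lt_or_ge i n with hi | hi
      · rw [h3 i hi]; exact h1 i hi.le
      · rw [h4 i hi]
    have hβ : η ≤ Ign.nab m β := Ign.le_nab_iff.2 fun i hi => by
      rw [h3 i (by omega)]; exact h2 i hi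
    refine Ign.le_nab_iff.2 fun i hi => (le_inf hα hβ i).trans ?_
    rcases lt_or_ge i n with hi' | hi'
    · rw [h3 i hi']
    · rw [h4 i hi']; exact h1 i hi

theorem Ign.isRCAlg_dia : IsRCAlg Ign.dia where
  mono n α β h := Ign.le_dia_iff.2 fun i hi => (h i).trans_lt (lt_dia n i hi α)
  trans n α := Ign.le_dia_iff.2 fun i hi => (lt_dia n i hi α).trans (lt_dia n i hi _)
  anti h α := Ign.le_dia_iff.2 fun i hi => lt_dia _ i (hi.trans h.le) α
  six {m n} hmn α β := by
    set γ := Ign.dia n α ⊓ Ign.dia m β with hγ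
    have h1 := Ign.le_dia_iff.1 (inf_le_left : γ ≤ Ign.dia n α)
    have h2 := Ign.le_dia_iff.1 (inf_le_right : γ ≤ Ign.dia m β)
    -- The least point below `α` from `m + 1` on and strictly below both `α` and `β` up to `m`.
    obtain ⟨η, h3, h4⟩ := Ign.exists_downward
      (fun i x => max (α.seq i) (β.seq i) + ω ^ x) (m + 1)
      (fun i _ x hx => ⟨add_lt_eps (max_lt (α.lt_eps i) (β.lt_eps i)) (opow_lt_eps hx),
        (ell_add_opow _ _).ge⟩) α
    have hlt : ∀ i < m + 1, max (α.seq i) (β.seq i) < η.seq i := fun i hi => by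
      rw [h4 i hi]
      exact lt_add_of_pos_right _ (opow_pos _ omega0_pos)
    have hα : η ≤ α := fun i => by
      rcases lt_or_ge i (m + 1) with hi | hi
      · exact (le_max_left _ _).trans (hlt i hi).le
      · rw [h3 i hi]
    have hβ : η ≤ Ign.dia m β := Ign.le_dia_iff.2 fun i hi =>
      (le_max_right _ _).trans_lt (hlt i (by omega))
    have hηγ : ∀ i ≤ n, η.seq i < γ.seq i := by
      have low : ∀ i ≤ m + 1, η.seq i < γ.seq i := fun i hi => by
        induction hi using Nat.decreasingInduction with
        | self => rw [h3 _ le_rfl]; exact h1 _ hmn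
        | of_succ i hi ih =>
          rw [h4 i hi]
          refine lt_of_lt_of_le ?_ (add_opow_le_of_lt
            (max_lt (h1 i (by omega)) (h2 i (by omega))) (γ.step i))
          have := (opow_lt_opow_iff_right one_lt_omega0).2 ih
          gcongr
      intro i hi
      rcases le_or_gt i (m + 1) with hi' | hi'
      · exact low i hi'
      · rw [h3 i hi'.le]; exact h1 i hi
    exact Ign.le_dia_iff.2 fun i hi => (le_inf hα hβ i).trans_lt (hηγ i hi)

theorem Ign.isRCNAlg : IsRCNAlg Ign.dia Ign.nab where
  dia := Ign.isRCAlg_dia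
  nab := Ign.isRCAlg_nab
  nabIntro n α := Ign.le_nab_iff.2 fun _ _ => le_rfl
  diaNab n α := Ign.le_nab_iff.2 fun i hi => (lt_dia n i hi α).le
  diaAbsorb {m n} h α := Ign.le_dia_iff.2 fun i hi => by
    simpa [Ign.nab_seq, hi.trans h] using lt_dia m i hi (Ign.nab n α)
  nabAbsorb {m n} h α := Ign.le_dia_iff.2 fun i hi => by
    simpa [Ign.nab_seq, hi.trans h] using lt_dia m i hi α

/-! ### Canonical elements of the Ignatiev algebra -/

/-- The value of `w_i(a)` in the Ignatiev algebra has entry `a` in position `i`, and the entries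
below are the least possible ones for a point with entry `a` there. -/
theorem Ign.canon_bounds {a : Ordinal.{0}} (ha : a < ε₀) (i : ℕ) :
    a ≤ (canon Ign.dia a i).seq i ∧ ∀ j ≤ i, (canon Ign.dia a i).seq j ≤ towerSeq a i j := by
  induction a using WellFoundedLT.induction generalizing i with
  | ind a ih =>
    rcases eq_or_ne a 0 with rfl | h0
    · rw [canon_zero]
      exact ⟨zero_le, fun j _ => zero_le⟩
    have hc := ell_lt_eps ha
    have hr := rem_lt_eps ha h0
    obtain ⟨c1, c2⟩ := ih _ (ell_lt ha h0) hc (i + 1)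
    obtain ⟨r1, r2⟩ := ih _ (rem_lt h0) hr i
    set p := canon Ign.dia (ell a) (i + 1) with hp
    set q := canon Ign.dia (rem a) i with hq
    rw [canon_eq ha h0]
    constructor
    · have h1 : p.seq (i + 1) ≤ (p ⊓ Ign.dia i q).seq (i + 1) := (inf_le_left : _ ≤ p) (i + 1)
      have h2 := Ign.le_dia_iff.1 (inf_le_right : p ⊓ Ign.dia i q ≤ Ign.dia i q) i le_rfl
      conv_lhs => rw [← rem_add_opow_ell h0]
      exact add_opow_le_of_lt (r1.trans_lt h2) ((c1.trans h1).trans (Ign.step _ i))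
    · have hpe : p.seq (i + 1) ≤ ell a := (c2 _ le_rfl).trans_eq (towerSeq_self _ _)
      -- The witness continues the tower with the tail of `p`.
      obtain ⟨η, h1, h2⟩ := Ign.exists_splice (i + 1) (Ign.tower a ha i) p (by
        rintro k hk
        obtain rfl : k = i := by omega
        show p.seq (k + 1) ≤ ell (towerSeq a k k)
        rwa [towerSeq_self])
      have hηp : η ≤ p := fun j => by
        rcases lt_or_ge j (i + 1) with hj | hj
        · rcases eq_or_ne (ell a) 0 with hl | hl
          · rw [hp, hl, canon_zero]
            exact zero_le
          · refine (c2 j hj.le).trans (Ign.towerSeq_le_of_le hl ?_ hj.le)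
            rw [h2 _ le_rfl]
            exact c1
        · exact (h2 j hj).ge
      have hηq : η ≤ Ign.dia i q := Ign.le_dia_iff.2 fun j hj => by
        rw [h1 j (by omega)]
        refine (r2 j hj).trans_lt (Ign.towerSeq_lt_of_lt (γ := Ign.tower a ha i) ?_ hj)
        exact (rem_lt h0).trans_eq (towerSeq_self a i).symm
      intro j hj
      exact (le_inf hηp hηq j).trans_eq (h1 j (by omega))

theorem Ign.canon_seq_self {a : Ordinal.{0}} (ha : a < ε₀) (i : ℕ) :
    (canon Ign.dia a i).seq i = a :=
  le_antisymm (((Ign.canon_bounds ha i).2 i le_rfl).trans_eq (towerSeq_self a i))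
    (Ign.canon_bounds ha i).1

theorem Ign.le_dia_canon_iff {a : Ordinal.{0}} (ha : a < ε₀) {i : ℕ} {γ : Ign} :
    γ ≤ Ign.dia i (canon Ign.dia a i) ↔ a < γ.seq i := by
  rw [Ign.le_dia_iff]
  refine ⟨fun h => (Ign.canon_seq_self ha i).symm.trans_lt (h i le_rfl), fun h j hj => ?_⟩
  exact ((Ign.canon_bounds ha i).2 j hj).trans_lt (Ign.towerSeq_lt_of_lt h hj)

theorem Ign.canon_seq_le {a : Ordinal.{0}} (ha : a < ε₀) {i : ℕ} {γ : Ign} (h : a ≤ γ.seq i)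
    {j : ℕ} (hj : j ≤ i) : (canon Ign.dia a i).seq j ≤ γ.seq j := by
  rcases eq_or_ne a 0 with rfl | h0
  · rw [canon_zero]
    exact zero_le
  · exact ((Ign.canon_bounds ha i).2 j hj).trans (Ign.towerSeq_le_of_le h0 h hj)

theorem Ign.le_nab_canon_iff {a : Ordinal.{0}} (ha : a < ε₀) {i : ℕ} {γ : Ign} :
    γ ≤ Ign.nab i (canon Ign.dia a i) ↔ a ≤ γ.seq i := by
  rw [Ign.le_nab_iff]
  exact ⟨fun h => (Ign.canon_seq_self ha i).symm.trans_le (h i le_rfl),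
    fun h j hj => Ign.canon_seq_le ha h hj⟩

/-! ### The Ignatiev algebra is the initial `RC^∇`-algebra -/

section Interp

variable {X : Type*} [SemilatticeInf X] [OrderTop X] {d b : ℕ → X → X}

/-- The normal form `⋀_i ∇_i w_i(α_i)` of the point `α`, in an arbitrary algebra. The conjunction
extends over the (finitely many) indices below a chosen bound for the support of `α`. -/
def Ign.interp (d b : ℕ → X → X) (α : Ign) : X :=
  (Finset.range α.eventually_zero.choose).inf fun i => b i (canon d (α.seq i) i)

namespace IsRCNAlg

theorem nab_top (h : IsRCNAlg d b) (n : ℕ) : b n ⊤ = ⊤ := top_le_iff.1 (h.nabIntro n ⊤)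

theorem le_interp_iff (h : IsRCNAlg d b) {α : Ign} {x : X} :
    x ≤ α.interp d b ↔ ∀ i, x ≤ b i (canon d (α.seq i) i) := by
  rw [Ign.interp, Finset.le_inf_iff]
  refine ⟨fun H i => ?_, fun H i _ => H i⟩
  rcases lt_or_ge i α.eventually_zero.choose with hi | hi
  · exact H i (Finset.mem_range.2 hi)
  · rw [α.eventually_zero.choose_spec i hi, canon_zero, h.nab_top]
    exact le_top

theorem interp_le (h : IsRCNAlg d b) (α : Ign) (i : ℕ) :
    α.interp d b ≤ b i (canon d (α.seq i) i) := h.le_interp_iff.1 le_rfl i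

theorem interp_top (h : IsRCNAlg d b) : (⊤ : Ign).interp d b = ⊤ :=
  top_le_iff.1 (h.le_interp_iff.2 fun i => by
    rw [Ign.top_seq, canon_zero, h.nab_top])

theorem nab_canon_le (h : IsRCNAlg d b) {a c : Ordinal.{0}} (ha : a < ε₀) (hc : c ≤ a)
    (i : ℕ) : b i (canon d a i) ≤ b i (canon d c i) := by
  rcases hc.eq_or_lt with rfl | hlt
  · exact le_rfl
  · exact (h.nab.mono i (h.dia.canon_le_dia ha hlt i)).trans
      ((h.nabAbsorb le_rfl _).trans (h.diaNab i _))

theorem interp_mono (h : IsRCNAlg d b) : Monotone (Ign.interp d b) := fun α _ hαβ =>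
  h.le_interp_iff.2 fun i =>
    (h.interp_le α i).trans (h.nab_canon_le (α.lt_eps i) (hαβ i) i)

/-- The conjuncts of index above `n` are recovered under `∇ₙ` one at a time: each entry of a point
is at most the exponent of the last term of the preceding one. -/
theorem interp_nab_le_succ (h : IsRCNAlg d b) (n : ℕ) (α : Ign) :
    (α.nab n).interp d b ≤ b n ((α.nab (n + 1)).interp d b) := by
  have key : ∀ i ≤ n, (α.nab n).interp d b ≤ b i (canon d (α.seq i) i) := fun i hi => by
    simpa [Ign.nab_seq, hi] using h.interp_le (α.nab n) i
  refine (h.nab.le_map_inf (key n le_rfl) fun i hi => key i hi.le).trans (h.nab.mono n ?_)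
  refine h.le_interp_iff.2 fun i => ?_
  rw [Ign.nab_seq]
  split_ifs with hi
  · rcases lt_trichotomy i n with hin | rfl | hin
    · exact inf_le_right.trans
        (Finset.inf_le (f := fun i => b i (canon d (α.seq i) i)) (Finset.mem_range.2 hin))
    · exact inf_le_left.trans (h.nabIntro i _)
    · obtain rfl : i = n + 1 := by omega
      exact inf_le_left.trans ((canon_le_ell (α.lt_eps n) n).trans
        ((h.nabIntro _ _).trans
          (h.nab_canon_le (ell_lt_eps (α.lt_eps n)) (α.step n) (n + 1))))
  · rw [canon_zero, h.nab_top]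
    exact le_top

theorem interp_nab (h : IsRCNAlg d b) (n : ℕ) (α : Ign) :
    (α.nab n).interp d b = b n (α.interp d b) := by
  apply le_antisymm
  -- Iterating up to a bound for the support of `α` recovers all of `α`.
  · have step : ∀ k, (α.nab n).interp d b ≤ b n ((α.nab (n + k)).interp d b) := by
      intro k
      induction k with
      | zero => exact h.nabIntro n _
      | succ k ih =>
        exact ih.trans ((h.nab.mono n (h.interp_nab_le_succ (n + k) α)).trans
          (h.nab.comp_le' (by omega) _))
    obtain ⟨N, hN⟩ := α.eventually_zero
    have hα : α.nab (n + N) = α := Ign.ext (funext fun i => by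
      rw [Ign.nab_seq]
      split_ifs with hi
      · rfl
      · exact (hN i (by omega)).symm)
    simpa only [hα] using step N
  · refine h.le_interp_iff.2 fun i => ?_
    rw [Ign.nab_seq]
    split_ifs with hi
    · exact (h.nab.mono n (h.interp_le α i)).trans (h.nab.comp_le hi _)
    · rw [canon_zero, h.nab_top]
      exact le_top

theorem interp_dia (h : IsRCNAlg d b) (n : ℕ) (α : Ign) :
    (α.dia n).interp d b = d n (α.interp d b) := by
  apply le_antisymm
  · have key : ∀ i ≤ n, (α.dia n).interp d b ≤ d i (canon d (α.seq i) i) := fun i hi =>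
      (h.interp_le _ i).trans ((h.nab.mono i (h.dia.canon_le_dia ((α.dia n).lt_eps i)
        (lt_dia n i hi α) i)).trans (h.nabAbsorb le_rfl _))
    refine (h.dia.le_map_inf (key n le_rfl) fun i hi => key i hi.le).trans
      ((h.dia.mono n (?_ : _ ≤ (α.nab n).interp d b)).trans ?_)
    · refine h.le_interp_iff.2 fun i => ?_
      rw [Ign.nab_seq]
      split_ifs with hi
      · rcases hi.lt_or_eq with hin | rfl
        · exact (inf_le_right.trans (Finset.inf_le (f := fun i => d i (canon d (α.seq i) i))
            (Finset.mem_range.2 hin))).trans (h.diaNab i _)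
        · exact inf_le_left.trans (h.nabIntro i _)
      · rw [canon_zero, h.nab_top]
        exact le_top
    · rw [h.interp_nab]
      exact h.diaAbsorb le_rfl _
  -- The canonical elements of the entries of `◇ₙα` follow from `◇ₙ` of the normal form, by
  -- recursion from position `n + 1` down.
  · have key : ∀ k i, i + k = n + 1 →
        d n (α.interp d b) ≤ canon d (diaSeq α.seq k i) i ∧ diaSeq α.seq k i < ε₀ := by
      intro k
      induction k with
      | zero =>
        intro i _
        rw [diaSeq, canon_zero]
        exact ⟨le_top, epsilon_pos 0⟩
      | succ k ih =>
        intro i hi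
        obtain ⟨h1, h2⟩ := ih (i + 1) (by omega)
        have hlt := add_lt_eps (α.lt_eps i) (opow_lt_eps h2)
        rw [diaSeq]
        refine ⟨?_, hlt⟩
        rw [h.dia.canon_add_opow hlt]
        refine le_inf h1 ?_
        exact (h.dia.anti_le (by omega) _).trans
          ((h.dia.mono i (h.interp_le α i)).trans (h.diaAbsorb le_rfl _))
    refine h.le_interp_iff.2 fun i => ?_
    show _ ≤ b i (canon d (diaSeq α.seq (n + 1 - i) i) i)
    rcases le_or_gt i n with hi | hi
    · exact (key _ i (by omega)).1.trans (h.nabIntro i _)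
    · rw [show n + 1 - i = 0 by omega, diaSeq, canon_zero, h.nab_top]
      exact le_top

theorem interp_inf (h : IsRCNAlg d b) (α β : Ign) :
    (α ⊓ β).interp d b = α.interp d b ⊓ β.interp d b := by
  apply le_antisymm (le_inf (h.interp_mono inf_le_left) (h.interp_mono inf_le_right))
  obtain ⟨M, hM⟩ := α.eventually_zero
  obtain ⟨N, hN⟩ := β.eventually_zero
  -- The maximum of the two entries is kept if the next entry of `g` permits it, and is otherwise
  -- raised by the least power of `ω` that does.
  obtain ⟨g, hg1, hg2⟩ := Ign.exists_downward
    (fun i x => if x ≤ ell (max (α.seq i) (β.seq i)) then max (α.seq i) (β.seq i)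
      else max (α.seq i) (β.seq i) + ω ^ x) (max M N)
    (fun i _ x hx => by
      have hμ := max_lt (α.lt_eps i) (β.lt_eps i)
      split_ifs with hle
      · exact ⟨hμ, hle⟩
      · exact ⟨add_lt_eps hμ (opow_lt_eps hx), (ell_add_opow _ _).ge⟩) ⊤
  have hmax : ∀ i, max (α.seq i) (β.seq i) ≤ g.seq i := fun i => by
    rcases lt_or_ge i (max M N) with hi | hi
    · rw [hg2 i hi]
      split_ifs
      · exact le_rfl
      · exact le_self_add
    · rw [hM i ((le_max_left _ _).trans hi), hN i ((le_max_right _ _).trans hi), max_self]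
      exact zero_le
  have hgα : g ≤ α := fun i => (le_max_left _ _).trans (hmax i)
  have hgβ : g ≤ β := fun i => (le_max_right _ _).trans (hmax i)
  refine le_trans ?_ (h.interp_mono (le_inf hgα hgβ))
  set y := α.interp d b ⊓ β.interp d b with hy
  refine h.le_interp_iff.2 fun i => ?_
  rcases le_total (max M N) i with hi | hi
  · rw [hg1 i hi, Ign.top_seq, canon_zero, h.nab_top]
    exact le_top
  induction hi using Nat.decreasingInduction with
  | self =>
    rw [hg1 _ le_rfl, Ign.top_seq, canon_zero, h.nab_top]
    exact le_top
  | of_succ i hi ih =>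
    have hlt := g.lt_eps i
    have hc := g.lt_eps (i + 1)
    rw [hg2 i hi] at hlt ⊢
    set c := g.seq (i + 1) with hcdef
    have hμ : y ≤ b i (canon d (max (α.seq i) (β.seq i)) i) := by
      rcases le_total (α.seq i) (β.seq i) with hle | hle
      · rw [max_eq_right hle]
        exact inf_le_right.trans (h.interp_le β i)
      · rw [max_eq_left hle]
        exact inf_le_left.trans (h.interp_le α i)
    have hμε := max_lt (α.lt_eps i) (β.lt_eps i)
    set μ := max (α.seq i) (β.seq i) with hμdef
    split_ifs at hlt ⊢ with hle
    · exact hμ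
    · rw [not_le] at hle
      rcases eq_or_ne μ 0 with h0 | h0
      · rw [h0, zero_add, h.dia.canon_opow hc (zero_le.trans_lt hle).ne']
        exact ih.trans (h.nab.anti (Nat.lt_succ_self i) _)
      · have hz : y ≤ b i (d i (canon d (rem μ) i)) :=
          hμ.trans (h.nab.mono i (h.dia.canon_le_dia hμε (rem_lt h0) i))
        rw [← rem_add_opow_of_ell_lt h0 hle] at hlt ⊢
        rw [h.dia.canon_add_opow hlt]
        refine ((le_inf ih hz).trans (h.nab.six (Nat.lt_succ_self i) _ _)).trans
          ((h.nab.anti (Nat.lt_succ_self i) _).trans (h.nab.mono i ?_))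
        exact inf_le_inf_left _ (h.nabAbsorb le_rfl _)

end IsRCNAlg

theorem Ign.interp_self (α : Ign) : α.interp Ign.dia Ign.nab = α :=
  eq_of_forall_le_iff fun γ => by
    rw [Ign.isRCNAlg.le_interp_iff]
    exact forall_congr' fun i => Ign.le_nab_canon_iff (α.lt_eps i)

theorem map_interp {Y : Type*} [SemilatticeInf Y] [OrderTop Y] {d' b' : ℕ → Y → Y} (φ : X → Y)
    (htop : φ ⊤ = ⊤) (hinf : ∀ x y, φ (x ⊓ y) = φ x ⊓ φ y) (hd : ∀ n x, φ (d n x) = d' n (φ x))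
    (hb : ∀ n x, φ (b n x) = b' n (φ x)) (α : Ign) : φ (α.interp d b) = α.interp d' b' := by
  rw [Ign.interp, Ign.interp, Finset.apply_inf_eq_inf_comp φ hinf htop]
  refine Finset.inf_congr rfl fun i _ => ?_
  rw [Function.comp, hb, map_canon φ htop hinf hd]

end Interp

/-! ### Lindenbaum algebras and soundness -/

theorem CFml.induction {S : Type} {P : CFml S → Prop} (top : P CFml.top)
    (and : ∀ A B, P A → P B → P (A.and B)) (dia : ∀ a A, P A → P (A.dia a)) (A : CFml S) :
    P A := by
  obtain ⟨A, hA⟩ := A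
  induction A with
  | var p => exact hA.elim
  | top => exact top
  | and A B ihA ihB => exact and ⟨A, hA.1⟩ ⟨B, hA.2⟩ (ihA hA.1) (ihB hA.2)
  | dia a A ih => exact dia a ⟨A, hA⟩ (ih hA)

/-- Provable equivalence of variable-free formulas. -/
def lindSetoid {S : Type} (Ax : Fml S → Fml S → Prop) : Setoid (CFml S) where
  r A B := Provable Ax A.1 B.1 ∧ Provable Ax B.1 A.1
  iseqv :=
    { refl := fun _ => ⟨.refl _, .refl _⟩
      symm := fun h => ⟨h.2, h.1⟩
      trans := fun h k => ⟨.cut h.1 k.1, .cut k.2 h.2⟩ }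

/-- The Lindenbaum algebra of the variable-free fragment of the logic with axioms `Ax`, ordered
by provability. -/
def Lind {S : Type} (Ax : Fml S → Fml S → Prop) : Type := Quotient (lindSetoid Ax)

namespace Lind

variable {S : Type} {Ax : Fml S → Fml S → Prop}

/-- The class of a variable-free formula. -/
def mk (Ax : Fml S → Fml S → Prop) (A : CFml S) : Lind Ax := Quotient.mk (lindSetoid Ax) A

theorem ind {P : Lind Ax → Prop} (h : ∀ A, P (mk Ax A)) (x : Lind Ax) : P x := Quotient.ind h x

instance : PartialOrder (Lind Ax) where
  le := Quotient.lift₂ (fun A B => Provable Ax A.1 B.1) fun _ _ _ _ h k =>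
    propext ⟨fun H => .cut h.2 (.cut H k.1), fun H => .cut h.1 (.cut H k.2)⟩
  le_refl := Quotient.ind fun _ => .refl _
  le_trans x y z := Quotient.inductionOn₃ x y z fun _ _ _ h k => .cut h k
  le_antisymm x y := Quotient.inductionOn₂ x y fun _ _ h k => Quotient.sound ⟨h, k⟩

theorem mk_le_mk {A B : CFml S} : mk Ax A ≤ mk Ax B ↔ Provable Ax A.1 B.1 := Iff.rfl

instance : SemilatticeInf (Lind Ax) where
  inf := Quotient.map₂ CFml.and fun _ _ h _ _ k => ⟨and_mono h.1 k.1, and_mono h.2 k.2⟩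
  inf_le_left x y := Quotient.inductionOn₂ x y fun _ _ => .andLeft _ _
  inf_le_right x y := Quotient.inductionOn₂ x y fun _ _ => .andRight _ _
  le_inf x y z := Quotient.inductionOn₃ x y z fun _ _ _ h k => .andIntro h k

instance : OrderTop (Lind Ax) where
  top := mk Ax CFml.top
  le_top := Quotient.ind fun _ => .top _

/-- The operation induced by a modality. -/
def dia (a : S) : Lind Ax → Lind Ax :=
  Quotient.map (CFml.dia a) fun _ _ h => ⟨.nec _ h.1, .nec _ h.2⟩

theorem mk_and (A B : CFml S) : mk Ax (A.and B) = mk Ax A ⊓ mk Ax B := rfl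

theorem mk_dia (a : S) (A : CFml S) : mk Ax (A.dia a) = dia a (mk Ax A) := rfl

theorem dia_mono (a : S) : Monotone (dia a : Lind Ax → Lind Ax) := fun x y =>
  Quotient.inductionOn₂ x y fun _ _ h => Provable.nec a h

theorem isRCAlg {d : ℕ → S} (h : ∀ {A B}, RCAxiom d A B → Ax A B) :
    IsRCAlg fun n => (dia (d n) : Lind Ax → Lind Ax) where
  mono n := dia_mono (d n)
  trans n := Lind.ind fun A => .ax (h (.trans n A.1))
  anti hmn := Lind.ind fun A => .ax (h (.mono hmn A.1))
  six hmn := Lind.ind fun A => Lind.ind fun B => .ax (h (.six hmn A.1 B.1))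

theorem isRCNAlg : IsRCNAlg (fun n => (dia (.dia n) : Lind RCNAxiom → Lind RCNAxiom))
    fun n => dia (.nab n) where
  dia := isRCAlg .rcDia
  nab := isRCAlg .rcNab
  nabIntro n := Lind.ind fun A => .ax (.nabIntro n A.1)
  diaNab n := Lind.ind fun A => .ax (.diaNab n A.1)
  diaAbsorb h := Lind.ind fun A => .ax (.diaAbsorb h A.1)
  nabAbsorb h := Lind.ind fun A => .ax (.nabAbsorb h A.1)

end Lind

/-- The value of a formula under an interpretation `f` of the modalities and a valuation `v`. -/
def Fml.eval {S : Type} {X : Type*} [SemilatticeInf X] [OrderTop X] (f : S → X → X) (v : ℕ → X) :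
    Fml S → X
  | .var p => v p
  | .top => ⊤
  | .and A B => A.eval f v ⊓ B.eval f v
  | .dia a A => f a (A.eval f v)

section Soundness

variable {S : Type} {X : Type*} [SemilatticeInf X] [OrderTop X] {f : S → X → X}

theorem Fml.eval_subst (v : ℕ → X) (A : Fml S) (p : ℕ) (C : Fml S) :
    (A.subst p C).eval f v = A.eval f (Function.update v p (C.eval f v)) := by
  induction A with
  | var q =>
    rw [Fml.subst, Fml.eval, Function.update_apply]
    split_ifs <;> rfl
  | top => rfl
  | and A B ihA ihB => rw [Fml.subst, Fml.eval, Fml.eval, ihA, ihB]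
  | dia a A ih => rw [Fml.subst, Fml.eval, Fml.eval, ih]

theorem Provable.eval_le {Ax : Fml S → Fml S → Prop} (hf : ∀ a, Monotone (f a))
    (hax : ∀ A B, Ax A B → ∀ v, A.eval f v ≤ B.eval f v) {A B : Fml S} (h : Provable Ax A B)
    (v : ℕ → X) : A.eval f v ≤ B.eval f v := by
  induction h generalizing v with
  | ax h => exact hax _ _ h v
  | refl A => exact le_rfl
  | top A => exact le_top
  | cut _ _ ih1 ih2 => exact (ih1 v).trans (ih2 v)
  | andLeft A B => exact inf_le_left
  | andRight A B => exact inf_le_right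
  | andIntro _ _ ih1 ih2 => exact le_inf (ih1 v) (ih2 v)
  | nec a _ ih => exact hf a (ih v)
  | subst p C _ ih =>
    rw [Fml.eval_subst, Fml.eval_subst]
    exact ih _

theorem RCAxiom.eval_le {d : ℕ → S} (h : IsRCAlg fun n => f (d n)) {A B : Fml S}
    (hAB : RCAxiom d A B) (v : ℕ → X) : A.eval f v ≤ B.eval f v := by
  cases hAB with
  | trans n A => exact h.trans n _
  | mono hmn A => exact h.anti hmn _
  | six hmn A B => exact h.six hmn _ _

end Soundness

/-- The interpretation of the modalities `◇ₙ` and `∇ₙ` in the Ignatiev algebra. -/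
def Ign.op : Mod → Ign → Ign
  | .dia n => Ign.dia n
  | .nab n => Ign.nab n

theorem RCN.eval_le {A B : Fml Mod} (h : RCN A B) (v : ℕ → Ign) :
    A.eval Ign.op v ≤ B.eval Ign.op v := by
  refine Provable.eval_le (fun a => ?_) (fun A B hAB => ?_) h v
  · cases a with
    | dia n => exact Ign.isRCAlg_dia.mono n
    | nab n => exact Ign.isRCAlg_nab.mono n
  · intro v
    cases hAB with
    | rcDia h => exact RCAxiom.eval_le (d := Mod.dia) Ign.isRCAlg_dia h v
    | rcNab h => exact RCAxiom.eval_le (d := Mod.nab) Ign.isRCAlg_nab h v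
    | nabIntro n A => exact Ign.isRCNAlg.nabIntro n _
    | diaNab n A => exact Ign.isRCNAlg.diaNab n _
    | diaAbsorb h A => exact Ign.isRCNAlg.diaAbsorb h _
    | nabAbsorb h A => exact Ign.isRCNAlg.nabAbsorb h _

theorem RC.eval_le {A B : Fml ℕ} (h : RC A B) (v : ℕ → Ign) :
    A.eval Ign.dia v ≤ B.eval Ign.dia v :=
  Provable.eval_le Ign.isRCAlg_dia.mono
    (fun _ _ hAB => RCAxiom.eval_le (d := id) Ign.isRCAlg_dia hAB) h v

/-! ### The Lindenbaum–Tarski algebra of `RC^∇` -/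

/-- The value in the Ignatiev algebra of a class of formulas of `RC^∇`. -/
def Lind.nval : Lind RCNAxiom → Ign :=
  Quotient.lift (fun A => A.1.eval Ign.op fun _ => ⊤) fun _ _ h =>
    le_antisymm (RCN.eval_le h.1 _) (RCN.eval_le h.2 _)

theorem Lind.nval_inf (x y : Lind RCNAxiom) : (x ⊓ y).nval = x.nval ⊓ y.nval :=
  Quotient.inductionOn₂ x y fun _ _ => rfl

theorem Lind.nval_dia (a : Mod) (x : Lind RCNAxiom) : (dia a x).nval = Ign.op a x.nval :=
  Quotient.inductionOn x fun _ => rfl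

theorem Lind.interp_nval (x : Lind RCNAxiom) :
    x.nval.interp (fun n => dia (.dia n)) (fun n => dia (.nab n)) = x := by
  induction x using Lind.ind with
  | h A =>
    induction A using CFml.induction with
    | top => exact isRCNAlg.interp_top
    | and A B ihA ihB =>
      rw [mk_and, nval_inf, isRCNAlg.interp_inf, ihA, ihB]
    | dia a A ih =>
      rw [mk_dia, nval_dia]
      cases a with
      | dia n => rw [Ign.op, isRCNAlg.interp_dia, ih]
      | nab n => rw [Ign.op, isRCNAlg.interp_nab, ih]

theorem Lind.nval_interp (α : Ign) : Lind.nval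
    (α.interp (fun n => Lind.dia (.dia n)) fun n => Lind.dia (.nab n)) = α :=
  (map_interp (d' := Ign.dia) (b' := Ign.nab) Lind.nval rfl Lind.nval_inf
    (fun n => Lind.nval_dia (.dia n)) (fun n => Lind.nval_dia (.nab n)) α).trans α.interp_self

theorem nonempty_nabIso_LTAlg_Ign : Nonempty (NabIso LTAlg Ign) :=
  ⟨{ toFun := Lind.nval
     invFun := Ign.interp (X := Lind RCNAxiom) (fun n => Lind.dia (.dia n))
       fun n => Lind.dia (.nab n)
     left_inv := Lind.interp_nval
     right_inv := Lind.nval_interp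
     map_meet := fun x y => Lind.nval_inf x y
     map_dia := fun n x => Lind.nval_dia (.dia n) x
     map_nab := fun n x => Lind.nval_dia (.nab n) x }⟩

/-! ### Completeness of `RC` for the Ignatiev algebra -/

/-- The value in the Ignatiev algebra of a variable-free formula of `RC`. -/
def CFml.val (A : CFml ℕ) : Ign := A.1.eval Ign.dia fun _ => ⊤

/-- The Lindenbaum algebra of the variable-free fragment of `RC`. -/
abbrev RCLind : Type := Lind (RCAxiom (id : ℕ → ℕ))

theorem RCLind.isRCAlg : IsRCAlg (Lind.dia : ℕ → RCLind → RCLind) :=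
  Lind.isRCAlg (d := id) fun h => h

/-- The value in the Ignatiev algebra of a class of formulas of `RC`. -/
def RCLind.val : RCLind → Ign :=
  Quotient.lift CFml.val fun _ _ h => le_antisymm (RC.eval_le h.1 _) (RC.eval_le h.2 _)

theorem RCLind.val_canon (a : Ordinal.{0}) (i : ℕ) :
    RCLind.val (canon Lind.dia a i) = canon Ign.dia a i :=
  map_canon RCLind.val rfl (fun x y => Quotient.inductionOn₂ x y fun _ _ => rfl)
    (fun _ x => Quotient.inductionOn x fun _ => rfl) a i

theorem RCLind.exists_mk_eq_canon (A : CFml ℕ) :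
    ∃ a < ε₀, canon Lind.dia a 0 = Lind.mk (RCAxiom id) A := by
  induction A using CFml.induction with
  | top => exact ⟨0, epsilon_pos 0, canon_zero 0⟩
  | and A B ihA ihB =>
    obtain ⟨a, ha, hA⟩ := ihA
    obtain ⟨b, hb, hB⟩ := ihB
    rw [Lind.mk_and, ← hA, ← hB]
    exact isRCAlg.exists_canon_inf ha hb 0
  | dia n A ih =>
    obtain ⟨a, ha, hA⟩ := ih
    rw [Lind.mk_dia, ← hA]
    exact isRCAlg.exists_canon_dia ha (Nat.zero_le n)

theorem CFml.val_le_val_iff {A B : CFml ℕ} : A.val ≤ B.val ↔ RC A.1 B.1 := by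
  refine ⟨fun h => ?_, fun h => RC.eval_le h _⟩
  obtain ⟨a, ha, hA⟩ := RCLind.exists_mk_eq_canon A
  obtain ⟨e, he, hE⟩ := RCLind.exists_mk_eq_canon (A.and B)
  have hval : (A.and B).val = A.val := inf_eq_left.2 h
  -- A canonical element of level `0` is determined by the first entry of its value.
  have hae : a = e := by
    have h1 : canon Ign.dia a 0 = A.val := by rw [← RCLind.val_canon, hA]; rfl
    have h2 : canon Ign.dia e 0 = (A.and B).val := by rw [← RCLind.val_canon, hE]; rfl
    rw [← Ign.canon_seq_self ha 0, ← Ign.canon_seq_self he 0, h1, h2, hval]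
  rw [hae, hE] at hA
  exact .cut (Lind.mk_le_mk.1 hA.ge) (.andRight _ _)

theorem IsWord.exists_eq_canon {i : ℕ} {A : CFml ℕ} (h : IsWord i A) :
    ∃ a < ε₀, A.val = canon Ign.dia a i := by
  suffices H : ∃ a < ε₀, canon Lind.dia a i = Lind.mk (RCAxiom id) A by
    obtain ⟨a, ha, hA⟩ := H
    exact ⟨a, ha, by rw [← RCLind.val_canon, hA]; rfl⟩
  induction h with
  | top => exact ⟨0, epsilon_pos 0, canon_zero i⟩
  | dia hm _ ih =>
    obtain ⟨a, ha, hA⟩ := ih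
    rw [Lind.mk_dia, ← hA]
    exact RCLind.isRCAlg.exists_canon_dia ha hm

/-- Concatenation of words: substituting `◇ₘB` for `⊤` in a word whose modalities exceed `m`
amounts to taking the conjunction with `◇ₘB`. -/
theorem IsWord.exists_val_eq_inf {m n : ℕ} (hmn : m < n) {A B : CFml ℕ} (hA : IsWord n A)
    (hB : IsWord m B) : ∃ C, IsWord m C ∧ C.val = A.val ⊓ Ign.dia m B.val := by
  induction hA with
  | top => exact ⟨B.dia m, hB.dia le_rfl, (top_inf_eq _).symm⟩
  | @dia k hk A _ ih =>
    obtain ⟨C, hC, h⟩ := ih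
    refine ⟨C.dia k, hC.dia (by omega), ?_⟩
    show Ign.dia k C.val = Ign.dia k A.val ⊓ _
    rw [h, Ign.isRCAlg_dia.map_inf_dia (by omega)]

theorem exists_isWord_val_eq_canon {a : Ordinal.{0}} (ha : a < ε₀) (i : ℕ) :
    ∃ A, IsWord i A ∧ A.val = canon Ign.dia a i := by
  induction a using WellFoundedLT.induction generalizing i with
  | ind a ih =>
    rcases eq_or_ne a 0 with rfl | h0
    · exact ⟨CFml.top, .top, (canon_zero i).symm⟩
    · obtain ⟨A, hA, hAv⟩ := ih _ (ell_lt ha h0) (ell_lt_eps ha) (i + 1)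
      obtain ⟨B, hB, hBv⟩ := ih _ (rem_lt h0) (rem_lt_eps ha h0) i
      rw [canon_eq ha h0, ← hAv, ← hBv]
      exact hA.exists_val_eq_inf (Nat.lt_succ_self i) hB

/-! ### Bounded theories as points of the Ignatiev frame -/

theorem isTheory_setOf_le_val (α : Ign) : IsTheory {A | α ≤ A.val} := by
  intro l B hl hB
  refine le_trans ?_ (CFml.val_le_val_iff.2 hB)
  clear hB
  induction l with
  | nil => exact (le_top : α ≤ ⊤)
  | cons C l ih =>
    exact le_inf (hl C (by simp)) (ih fun D hD => hl D (by simp [hD]))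

theorem Ign.exists_val_le (α : Ign) : ∃ A : CFml ℕ, A.val ≤ α := by
  obtain ⟨N, hN⟩ := α.eventually_zero
  have H : ∀ k, ∃ A : CFml ℕ, ∀ i < k, α.seq i ≤ A.val.seq i := by
    intro k
    induction k with
    | zero => exact ⟨CFml.top, fun _ h => absurd h (Nat.not_lt_zero _)⟩
    | succ k ih =>
      obtain ⟨A, hA⟩ := ih
      obtain ⟨B, -, hB⟩ := exists_isWord_val_eq_canon (α.lt_eps k) k
      refine ⟨A.and B, fun i hi => ?_⟩
      rcases Nat.lt_succ_iff_lt_or_eq.1 hi with hi | rfl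
      · exact (hA i hi).trans ((inf_le_left : A.val ⊓ B.val ≤ _) i)
      · refine le_trans ?_ ((inf_le_right : A.val ⊓ B.val ≤ _) i)
        rw [hB, Ign.canon_seq_self (α.lt_eps i)]
  obtain ⟨A, hA⟩ := H N
  refine ⟨A, fun i => ?_⟩
  rcases lt_or_ge i N with hi | hi
  · exact hA i hi
  · rw [hN i hi]
    exact zero_le

/-- The bounded theory of the formulas that hold at a point of the Ignatiev frame. -/
def BTh.ofIgn (α : Ign) : BTh :=
  ⟨{A | α ≤ A.val}, isTheory_setOf_le_val α, by
    obtain ⟨A, hA⟩ := α.exists_val_le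
    exact ⟨A, fun B hB => CFml.val_le_val_iff.1 (hA.trans hB)⟩⟩

namespace BTh

theorem mem_ofIgn {α : Ign} {A : CFml ℕ} : A ∈ (ofIgn α).1 ↔ α ≤ A.val := Iff.rfl

/-- The entry `α_i` is determined by the formulas `◇_i w_i(b)`, `b < α_i`, in the theory. -/
theorem exists_dia_mem_ofIgn {α : Ign} {i : ℕ} {c : Ordinal.{0}} (h : c < α.seq i) :
    ∃ A, IsWord i A ∧ α ≤ (A.dia i).val ∧ ∀ γ : Ign, γ ≤ (A.dia i).val → c < γ.seq i := by
  have hc := h.trans (α.lt_eps i)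
  obtain ⟨A, hA, hv⟩ := exists_isWord_val_eq_canon hc i
  have hd : (A.dia i).val = Ign.dia i (canon Ign.dia c i) := by rw [← hv]; rfl
  exact ⟨A, hA, hd ▸ (Ign.le_dia_canon_iff hc).2 h, fun γ hγ =>
    (Ign.le_dia_canon_iff hc).1 (hd ▸ hγ)⟩

theorem ofIgn_subset_iff {α β : Ign} : (ofIgn α).1 ⊆ (ofIgn β).1 ↔ β ≤ α := by
  refine ⟨fun h i => le_of_forall_lt fun c hc => ?_, fun h A hA => h.trans hA⟩
  obtain ⟨A, -, h1, h2⟩ := exists_dia_mem_ofIgn hc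
  exact h2 β (h h1)

theorem ofIgn_injective : Function.Injective ofIgn := fun _ _ h =>
  le_antisymm (ofIgn_subset_iff.1 (congrArg Subtype.val h).ge)
    (ofIgn_subset_iff.1 (congrArg Subtype.val h).le)

theorem and_mem {T : Set (CFml ℕ)} (hT : IsTheory T) {A B : CFml ℕ} (hA : A ∈ T) (hB : B ∈ T) :
    A.and B ∈ T := by
  refine hT [A, B] (A.and B) (by simp [hA, hB]) ?_
  exact .andIntro (.andLeft _ _) (.cut (.andRight _ _) (.andLeft _ _))

theorem mem_of_val_le {T : Set (CFml ℕ)} (hT : IsTheory T) {A B : CFml ℕ} (hA : A ∈ T)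
    (h : A.val ≤ B.val) : B ∈ T :=
  hT [A] B (by simp [hA]) (.cut (.andLeft _ _) (CFml.val_le_val_iff.1 h))

/-- The point of a bounded theory: its entries are the suprema of the entries of the values of
the members of the theory. -/
theorem exists_sup (T : BTh) : ∃ σ : Ign, (∀ A ∈ T.1, σ ≤ A.val) ∧
    ∀ i, ∀ c < σ.seq i, ∃ A ∈ T.1, c < A.val.seq i := by
  obtain ⟨T, hT, C, hC⟩ := T
  have htop : CFml.top ∈ T := hT [] _ (by simp) (.refl _)
  have hbd : ∀ i, BddAbove ((fun A : CFml ℕ => A.val.seq i) '' T) := fun i =>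
    ⟨C.val.seq i, by rintro _ ⟨A, hA, rfl⟩; exact CFml.val_le_val_iff.2 (hC hA) i⟩
  have hle : ∀ i, ∀ A ∈ T, A.val.seq i ≤ sSup ((fun A : CFml ℕ => A.val.seq i) '' T) :=
    fun i A hA => le_csSup (hbd i) ⟨A, hA, rfl⟩
  have hlt : ∀ i, ∀ c < sSup ((fun A : CFml ℕ => A.val.seq i) '' T),
      ∃ A ∈ T, c < A.val.seq i := by
    intro i c hc
    obtain ⟨_, ⟨A, hA, rfl⟩, h⟩ := exists_lt_of_lt_csSup (Set.image_nonempty.2 ⟨_, htop⟩) hc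
    exact ⟨A, hA, h⟩
  refine ⟨⟨fun i => sSup ((fun A : CFml ℕ => A.val.seq i) '' T), fun i => ?_, fun i => ?_⟩,
    fun A hA i => hle i A hA, hlt⟩
  · refine (csSup_le' ?_).trans_lt (C.val.lt_eps i)
    rintro _ ⟨A, hA, rfl⟩
    exact CFml.val_le_val_iff.2 (hC hA) i
  · by_contra! hcon
    obtain ⟨A, hA, hA'⟩ := hlt (i + 1) _ hcon
    set σ := sSup ((fun A : CFml ℕ => A.val.seq i) '' T) with hσ
    have h0 : σ ≠ 0 := by
      intro h0
      have h1 : A.val.seq i = 0 := le_antisymm (h0 ▸ hle i A hA) zero_le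
      have h2 := A.val.step i
      rw [h1, ell_zero] at h2
      exact absurd hA' (not_lt.2 (h2.trans zero_le))
    -- As `T` is directed, one member exceeds `ell σ` in position `i + 1` and `rem σ` in position
    -- `i`, which forces its entry in position `i` above `σ`.
    obtain ⟨B, hB, hB'⟩ := hlt i (rem σ) (rem_lt h0)
    have h1 := hA'.trans_le ((inf_le_left : (A.and B).val ≤ A.val) (i + 1))
    have h2 := hB'.trans_le ((inf_le_right : (A.and B).val ≤ B.val) i)
    have h3 := add_opow_le_of_lt h2 ((Order.succ_le_of_lt h1).trans ((A.and B).val.step i))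
    have h4 : rem σ + ω ^ ell σ < rem σ + ω ^ Order.succ (ell σ) := by
      have := (opow_lt_opow_iff_right one_lt_omega0).2 (Order.lt_succ (ell σ))
      gcongr
    rw [rem_add_opow_ell h0] at h4
    exact absurd (h4.trans_le h3) (not_lt.2 (hle i _ (and_mem hT hA hB)))

/-- Membership of a formula with value `w_i(a)` is shown by induction on `a`: of the two conjuncts
of `w_i(a)`, the second follows from any member with entry above `rem a` in position `i`. -/
theorem ofIgn_surjective : Function.Surjective ofIgn := by
  intro T
  obtain ⟨σ, h1, h2⟩ := exists_sup T
  obtain ⟨hT, -⟩ := T.2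
  have key : ∀ a < ε₀, ∀ i, σ ≤ canon Ign.dia a i → ∀ A : CFml ℕ, A.val = canon Ign.dia a i →
      A ∈ T.1 := by
    intro a
    induction a using WellFoundedLT.induction with
    | ind a ih =>
      intro ha i hσ A hA
      have htop : CFml.top ∈ T.1 := hT [] _ (by simp) (.refl _)
      rcases eq_or_ne a 0 with rfl | h0
      · refine mem_of_val_le hT htop ?_
        rw [hA, canon_zero]
        exact le_top
      · rw [canon_eq ha h0] at hσ hA
        obtain ⟨B, -, hB⟩ := exists_isWord_val_eq_canon (ell_lt_eps ha) (i + 1)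
        have hBT : B ∈ T.1 :=
          ih _ (ell_lt ha h0) (ell_lt_eps ha) (i + 1) (hσ.trans inf_le_left) B hB
        have hlt := (Ign.le_dia_canon_iff (rem_lt_eps ha h0)).1 (hσ.trans inf_le_right)
        obtain ⟨D, hDT, hD⟩ := h2 i _ hlt
        refine mem_of_val_le hT (and_mem hT hBT hDT) ?_
        rw [hA]
        exact le_inf (inf_le_left.trans_eq hB)
          (inf_le_right.trans ((Ign.le_dia_canon_iff (rem_lt_eps ha h0)).2 hD))
  refine ⟨σ, Subtype.ext (Set.Subset.antisymm (fun A hA => ?_) h1)⟩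
  obtain ⟨a, ha, hE⟩ := RCLind.exists_mk_eq_canon A
  have hv : A.val = canon Ign.dia a 0 := by rw [← RCLind.val_canon, hE]; rfl
  exact key a ha 0 (hv ▸ hA) A hv

/-- The theory generated by `X` corresponds to the greatest lower bound of the values of the
elements of `X`. -/
theorem gen_eq_ofIgn {X : Set (CFml ℕ)} (hX : IsBounded X) {γ : Ign}
    (h : ∀ δ, δ ≤ γ ↔ ∀ A ∈ X, δ ≤ A.val) : gen X hX = ofIgn γ := by
  obtain ⟨δ, hδ⟩ := ofIgn_surjective (gen X hX)
  have h1 : X ⊆ (ofIgn δ).1 := hδ ▸ subset_gen X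
  have h2 : (ofIgn δ).1 ⊆ (ofIgn γ).1 := by
    rw [hδ]
    exact gen_subset (ofIgn γ).2.1 ((h γ).1 le_rfl)
  rw [← hδ, le_antisymm ((h δ).2 h1) (ofIgn_subset_iff.1 h2)]

theorem single_eq (A : CFml ℕ) : single A = ofIgn A.val :=
  gen_eq_ofIgn _ fun δ => by simp

theorem meet_ofIgn (α β : Ign) : meet (ofIgn α) (ofIgn β) = ofIgn (α ⊓ β) :=
  gen_eq_ofIgn _ fun δ => by
    rw [le_inf_iff, ← ofIgn_subset_iff, ← ofIgn_subset_iff, ← Set.union_subset_iff]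
    rfl

theorem nab_ofIgn (n : ℕ) (α : Ign) : nab n (ofIgn α) = ofIgn (Ign.nab n α) := by
  refine gen_eq_ofIgn _ fun δ => ⟨?_, fun h => Ign.le_nab_iff.2 fun i hi => ?_⟩
  · rintro h _ ⟨hα, m, hm, A, rfl⟩
    exact h.trans ((Ign.isRCAlg_nab.mono n hα).trans (Ign.isRCNAlg.nabAbsorb hm _))
  · refine le_of_forall_lt fun c hc => ?_
    obtain ⟨A, -, h1, h2⟩ := exists_dia_mem_ofIgn hc
    exact h2 δ (h _ ⟨h1, i, hi, A, rfl⟩)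

theorem dia_nab_eq (n : ℕ) (α : Ign) : Ign.dia n (Ign.nab n α) = Ign.dia n α :=
  le_antisymm (Ign.isRCNAlg.diaAbsorb le_rfl α)
    (Ign.isRCAlg_dia.mono n (Ign.isRCNAlg.nabIntro n α))

theorem nab_single_eq_iff {n : ℕ} {A : CFml ℕ} {τ : Ign} :
    nab n (single A) = nab n (ofIgn τ) ↔ Ign.nab n A.val = Ign.nab n τ := by
  rw [single_eq, nab_ofIgn, nab_ofIgn, ofIgn_injective.eq_iff]

theorem single_dia_eq {n : ℕ} {A : CFml ℕ} {τ : Ign}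
    (h : nab n (single A) = nab n (ofIgn τ)) : single (A.dia n) = ofIgn (Ign.dia n τ) := by
  rw [nab_single_eq_iff] at h
  rw [single_eq]
  show ofIgn (Ign.dia n A.val) = _
  rw [← dia_nab_eq, h, dia_nab_eq]

/-- For a theory of level at least `n` with point `τ`, the word with value `w_n(τ_n)` is as
required in the definition of `diaLevel`: below `n`, all its entries and those of `τ` are the
least possible ones. -/
theorem exists_isWord_nab_eq {n : ℕ} {τ : Ign} (h : LevelGE n (ofIgn τ)) :
    ∃ A, IsWord n A ∧ nab n (single A) = nab n (ofIgn τ) := by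
  obtain ⟨X, hX, hgen⟩ := h
  have hglb : ∀ δ, (∀ A ∈ X, δ ≤ A.val) → δ ≤ τ := fun δ hδ =>
    ofIgn_subset_iff.1 (hgen ▸ gen_subset (ofIgn δ).2.1 hδ)
  obtain ⟨A, hA, hv⟩ := exists_isWord_val_eq_canon (τ.lt_eps n) n
  refine ⟨A, hA, nab_single_eq_iff.2 ?_⟩
  rw [hv]
  refine le_antisymm ?_ ?_
  · obtain ⟨η, h1, h2⟩ := Ign.exists_splice_of_le n (canon Ign.dia (τ.seq n) n) τ
      (Ign.canon_seq_self (τ.lt_eps n) n).ge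
    have hη : η ≤ τ := hglb η fun B hB => by
      have hBτ : τ ≤ B.val := by
        rw [← mem_ofIgn, hgen]
        exact subset_gen X hB
      obtain ⟨c, hc, hcv⟩ := (hX B hB).exists_eq_canon
      rw [hcv] at hBτ ⊢
      intro i
      rcases lt_or_ge i n with hi | hi
      · refine Ign.canon_seq_le hc ?_ hi.le
        rw [h2 n le_rfl, ← Ign.canon_seq_self hc n]
        exact hBτ n
      · rw [h2 i hi]
        exact hBτ i
    refine Ign.le_nab_iff.2 fun i hi => ?_
    rw [Ign.nab_seq, if_pos hi]
    rcases hi.lt_or_eq with hi | rfl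
    · rw [← h1 i hi]
      exact hη i
    · rw [Ign.canon_seq_self (τ.lt_eps i)]
  · refine Ign.le_nab_iff.2 fun i hi => ?_
    rw [Ign.nab_seq, if_pos hi]
    exact Ign.canon_seq_le (τ.lt_eps n) le_rfl hi

theorem diaLevel_ofIgn {n : ℕ} {τ : Ign} (h : LevelGE n (ofIgn τ)) :
    diaLevel n (ofIgn τ) = ofIgn (Ign.dia n τ) := by
  have hex := exists_isWord_nab_eq h
  rw [diaLevel, dif_pos hex]
  exact single_dia_eq hex.choose_spec.2

theorem diaLevel_part_ofIgn (i : ℕ) (α : Ign) : ∃ τ : Ign,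
    diaLevel i (part i (ofIgn α)) = ofIgn (Ign.dia i τ) ∧ α ≤ τ ∧ α.seq i ≤ τ.seq i := by
  have hl : LevelGE i (part i (ofIgn α)) := ⟨_, fun A hA => hA.2, rfl⟩
  obtain ⟨τ, hτ⟩ := ofIgn_surjective (part i (ofIgn α))
  rw [← hτ] at hl ⊢
  refine ⟨τ, diaLevel_ofIgn hl, ?_, le_of_forall_lt fun c hc => ?_⟩
  · rw [← ofIgn_subset_iff, hτ]
    exact gen_subset (ofIgn α).2.1 fun A hA => hA.1
  · obtain ⟨A, hA, h1, h2⟩ := exists_dia_mem_ofIgn hc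
    refine h2 τ ?_
    rw [← mem_ofIgn, hτ]
    exact subset_gen _ ⟨h1, hA.dia le_rfl⟩

theorem bigMeet_ofIgn {f : ℕ → BTh} {σ : ℕ → Ign} (h : ∀ i, f i = ofIgn (σ i)) (n : ℕ) :
    ∃ δ, bigMeet f n = ofIgn δ ∧ ∀ γ, γ ≤ δ ↔ ∀ i ≤ n, γ ≤ σ i := by
  induction n with
  | zero => exact ⟨σ 0, h 0, fun γ => by simp⟩
  | succ n ih =>
    obtain ⟨δ, h1, h2⟩ := ih
    refine ⟨δ ⊓ σ (n + 1), by rw [bigMeet, h1, h, meet_ofIgn], fun γ => ?_⟩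
    rw [le_inf_iff, h2]
    refine ⟨fun H i hi => ?_, fun H => ⟨fun i hi => H i (by omega), H _ le_rfl⟩⟩
    rcases Nat.le_succ_iff.1 hi with hi | rfl
    exacts [H.1 i hi, H.2]

theorem dia_ofIgn (n : ℕ) (α : Ign) : dia n (ofIgn α) = ofIgn (Ign.dia n α) := by
  choose τ h1 h2 h3 using fun i => diaLevel_part_ofIgn i α
  obtain ⟨δ, h4, h5⟩ := bigMeet_ofIgn h1 n
  rw [dia, h4]
  congr 1
  refine eq_of_forall_le_iff fun γ => ?_
  rw [h5]
  simp only [Ign.le_dia_iff]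
  exact ⟨fun H i hi => (h3 i).trans_lt (H i hi i le_rfl),
    fun H i hi j hj => (h2 i j).trans_lt (H j (hj.trans hi))⟩

end BTh

theorem nonempty_nabIso_Ign_BTh : Nonempty (NabIso Ign BTh) :=
  ⟨{ Equiv.ofBijective BTh.ofIgn ⟨BTh.ofIgn_injective, BTh.ofIgn_surjective⟩ with
     map_meet := fun α β => (BTh.meet_ofIgn α β).symm
     map_dia := fun n α => (BTh.dia_ofIgn n α).symm
     map_nab := fun n α => (BTh.nab_ofIgn n α).symm }⟩

/-! ### Cones of the Ignatiev frame -/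

namespace Cone

/-- The cone of the points below `δ`. -/
def ofIgn (δ : Ign) : Cone :=
  ⟨coneAt δ.seq, ⟨δ, fun _ => le_rfl⟩, δ.seq, fun i => (δ.lt_eps i).le, rfl⟩

theorem mem_ofIgn {γ δ : Ign} : γ ∈ (ofIgn δ).1 ↔ γ ≤ δ := Iff.rfl

theorem ofIgn_bijective : Function.Bijective ofIgn := by
  refine ⟨fun δ η h => ?_, fun C => ?_⟩
  · exact eq_of_forall_le_iff fun γ => by rw [← mem_ofIgn, h, mem_ofIgn]
  · obtain ⟨δ, hδ⟩ := C.2.exists_eq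
    exact ⟨δ, Subtype.ext hδ.symm⟩

theorem ofIgn_inf (δ η : Ign) : ofIgn (δ ⊓ η) = meet (ofIgn δ) (ofIgn η) :=
  Subtype.ext (Set.ext fun γ => (le_inf_iff : γ ≤ δ ⊓ η ↔ _))

theorem ofIgn_dia (n : ℕ) (δ : Ign) : ofIgn (Ign.dia n δ) = dia n (ofIgn δ) := by
  refine Subtype.ext (Set.ext fun γ => ?_)
  rw [mem_ofIgn, Ign.le_dia_iff]
  refine Iff.trans ?_ Set.mem_iInter.symm
  refine ⟨fun h i => (mem_rInv_coneAt i.1 δ γ).2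
    ⟨fun j hj => (h j (hj.le.trans i.2)).le, h i.1 i.2⟩,
    fun h i hi => ((mem_rInv_coneAt i δ γ).1 (h ⟨i, hi⟩)).2⟩

theorem ofIgn_nab (n : ℕ) (δ : Ign) : ofIgn (Ign.nab n δ) = nab n (ofIgn δ) := by
  refine Subtype.ext (Set.ext fun γ => ?_)
  rw [mem_ofIgn, Ign.le_nab_iff]
  refine Iff.trans ?_ Set.mem_iInter.symm
  constructor
  · rintro h ⟨⟨D, i⟩, hi, hD⟩
    obtain ⟨η, hη⟩ := D.2.exists_eq
    have h1 : δ ∈ rInv i D.1 := hD (mem_ofIgn.2 le_rfl)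
    show γ ∈ rInv i D.1
    rw [hη, mem_rInv_coneAt] at h1 ⊢
    exact ⟨fun j hj => (h1.1 j hj).trans (h j (hj.le.trans hi)), h1.2.trans_le (h i hi)⟩
  · intro h i hi
    by_contra! hlt
    -- The cone of `η` separates `γ` from `δ`, as `η_i = γ_i < δ_i`.
    obtain ⟨η, h1, h2⟩ := Ign.exists_splice_of_le i δ γ hlt.le
    have hsub : (ofIgn δ).1 ⊆ rInv i (ofIgn η).1 := fun ξ hξ =>
      (mem_rInv_coneAt i η ξ).2 ⟨fun j hj => (h1 j hj).trans_le (hξ j),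
        (h2 i le_rfl).trans_lt (hlt.trans_le (hξ i))⟩
    have h3 := ((mem_rInv_coneAt i η γ).1 (h ⟨(ofIgn η, i), hi, hsub⟩)).2
    rw [h2 i le_rfl] at h3
    exact lt_irrefl _ h3

end Cone

theorem nonempty_nabIso_Ign_Cone : Nonempty (NabIso Ign Cone) :=
  ⟨{ Equiv.ofBijective Cone.ofIgn Cone.ofIgn_bijective with
     map_meet := Cone.ofIgn_inf
     map_dia := Cone.ofIgn_dia
     map_nab := Cone.ofIgn_nab }⟩

end RCNabla

end

theorem mainTheorem1 :
    (∀ (n : ℕ) (T : RCNabla.BTh), RCNabla.BTh.LevelGE n T →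
      (∃ A : RCNabla.CFml ℕ, RCNabla.IsWord n A ∧
        RCNabla.BTh.nab n (RCNabla.BTh.single A) = RCNabla.BTh.nab n T) ∧
      (∀ A : RCNabla.CFml ℕ, RCNabla.IsWord n A →
        RCNabla.BTh.nab n (RCNabla.BTh.single A) = RCNabla.BTh.nab n T →
        RCNabla.BTh.diaLevel n T = RCNabla.BTh.single (RCNabla.CFml.dia n A))) ∧
    Nonempty (RCNabla.NabIso RCNabla.LTAlg RCNabla.Ign) ∧
    Nonempty (RCNabla.NabIso RCNabla.Ign RCNabla.BTh) ∧
    Nonempty (RCNabla.NabIso RCNabla.Ign RCNabla.Cone) := by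
  refine ⟨fun n T hT => ?_, RCNabla.nonempty_nabIso_LTAlg_Ign, RCNabla.nonempty_nabIso_Ign_BTh,
    RCNabla.nonempty_nabIso_Ign_Cone⟩
  obtain ⟨τ, rfl⟩ := RCNabla.BTh.ofIgn_surjective T
  exact ⟨RCNabla.BTh.exists_isWord_nab_eq hT, fun A _ hA =>
    (RCNabla.BTh.diaLevel_ofIgn hT).trans (RCNabla.BTh.single_dia_eq hA).symm⟩
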